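/- Let $\Theta\subseteq\mathbb{R}^d$ be open and connected, $N\ge 1$, and let $f_i=f(x_i;\cdot):\Theta\to[\widetilde F_{\min},\widetilde F_{\max}]$, $i\in[N]$, be differentiable and $L$-Lipschitz. Let $t>0$, $\Delta:=\widetilde F_{\max}-\widetilde F_{\min}$, and let $$\widetilde R(t;\theta):=\tfrac1t\log\Big(\tfrac1N\sum_{i\in[N]}e^{tf_i(\theta)}\Big)$$ be the $t$-tilted empirical risk, with $\breve\theta(t)\in\arg\min_{\theta\in\Theta}\widetilde R(t;\theta)$ (assumed to exist). Assume that $\widetilde R(t;\cdot)$ is $\beta$-smooth on $\Theta$ (its gradient is $\beta$-Lipschitz) and that $\big\|e^{t(f_i(\theta)-\widetilde R(t;\theta))}\nabla f_i(\theta)\big\|\le B$ for all $\theta\in\Theta$, $i\in[N]$. Assume further that there is $\mu>0$ such that for every $\mathbf p$ in the probability simplex $\Delta_N$ the function $g=\sum_i p_if_i$ is $\frac\mu2$-PL on $\Theta$, i.e. $\frac\mu2\,(g(\theta)-\inf_\Theta g)\le\frac12\|\nabla g(\theta)\|^2$ for all $\theta\in\Theta$. Let $k_t$ be the largest integer $k\ge1$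 with $$k<\frac{4e}{\mu}+\frac{4e\,tLB\,e^{t\Delta}}{\mu k}$$ ($k_t:=0$ if there is none), and put $\lambda=1-\frac1{2e}$, $\alpha_k=\frac{1}{tLBe^{t\Delta}+1}$ for $k<k_t$ and $\alpha_k=\frac{4e}{\mu k}$ for $k\ge k_t$. Let $\zeta_1,\xi_1,\zeta_2,\xi_2,\dots$ be independent and uniformly distributed on $[N]$. The stochastic TERM solver with two independent mini-batches of size 1 starts at a given $\theta_1\in\Theta$ with $r_0=\widetilde R(t;\theta_1)$, and for $k=1,2,\dots$ sets $$r_k=\tfrac1t\log\big((1-\lambda)e^{tr_{k-1}}+\lambda e^{tf_{\xi_k}(\theta_k)}\big),\qquad \theta_{k+1}=\theta_k-\alpha_k\,e^{t(f_{\zeta_k}(\theta_k)-r_k)}\,\nabla f_{\zeta_k}(\theta_k).$$ Assume that almost surely the run stays in $\Theta$, i.e. each segment $[\theta_k,\theta_{k+1}]$ lies in $\Theta$ (for convex $\Theta$: each $\theta_k$ does). Then $\widetilde R(t;\theta_k)$ is integrable for every $k$, and for all $k\ge k_t$ $$\mathbb E\big[\widetilde R(t;\theta_{k+1})-\widetilde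 R(t;\breve\theta(t))\big]\le\frac{V_t}{k+1},\qquad V_t=\max\Big\{k_t\,\mathbb E\big[\widetilde R(t;\theta_{k_t})-\widetilde R(t;\breve\theta(t))\big],\ \frac{8\beta B^2e^{2t\Delta+2}}{\mu^2}\Big\}.$$ -/

import Mathlib

open MeasureTheory ProbabilityTheory
open scoped NNReal

namespace TERM

noncomputable section

/-- The `t`-tilted empirical risk `(1/t) log ((1/N) ∑ i, exp (t f_i(θ)))` of the sample losses
`f 0, …, f (N-1)`, where `f i = f(x_i; ·)`. -/
def tiltedRisk {d N : ℕ} (f : Fin N → EuclideanSpace ℝ (Fin d) → ℝ) (t : ℝ)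
    (θ : EuclideanSpace ℝ (Fin d)) : ℝ :=
  (1 / t) * Real.log ((1 / (N : ℝ)) * ∑ i, Real.exp (t * f i θ))

/-- The stochastic gradient of the tilted risk at sample `i`:
`(exp (t f_i(θ)) / exp (t R(t;θ))) ∇f_i(θ)`. -/
def tiltedStochGrad {d N : ℕ} (f : Fin N → EuclideanSpace ℝ (Fin d) → ℝ) (t : ℝ) (i : Fin N)
    (θ : EuclideanSpace ℝ (Fin d)) : EuclideanSpace ℝ (Fin d) :=
  (Real.exp (t * f i θ) / Real.exp (t * tiltedRisk f t θ)) • gradient (f i) θ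

/-- `g` is `β`-smooth on `Θ`: differentiable there with `β`-Lipschitz gradient. -/
def IsSmoothOn {d : ℕ} (β : ℝ≥0) (g : EuclideanSpace ℝ (Fin d) → ℝ)
    (Θ : Set (EuclideanSpace ℝ (Fin d))) : Prop :=
  DifferentiableOn ℝ g Θ ∧ LipschitzOnWith β (gradient g) Θ

/-- The Polyak-Łojasiewicz condition on `Θ` with constant `m`:
`m (g(θ) - inf_Θ g) ≤ ‖∇g(θ)‖² / 2` on `Θ`. The infimum is spelled out as a universally
quantified competitor `θ'`. -/
def IsPLOn {d : ℕ} (m : ℝ) (g : EuclideanSpace ℝ (Fin d) → ℝ)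
    (Θ : Set (EuclideanSpace ℝ (Fin d))) : Prop :=
  ∀ θ ∈ Θ, ∀ θ' ∈ Θ, m * (g θ - g θ') ≤ (1 / 2) * ‖gradient g θ‖ ^ 2

/-- One pass of the two-mini-batch stochastic TERM loop with batch size 1, from the state
`(θ, estimate of the tilted risk)`. The sample `j` updates the estimate (the tilted loss on the
one-element batch `{j}` is `f j θ`), then the sample `i` and the updated estimate give the weight
and the gradient of the step on `θ`. -/
def step {d N : ℕ} (f : Fin N → EuclideanSpace ℝ (Fin d) → ℝ) (t lam α : ℝ) (i j : Fin N)
    (s : EuclideanSpace ℝ (Fin d) × ℝ) : EuclideanSpace ℝ (Fin d) × ℝ :=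
  let r : ℝ :=
    (1 / t) * Real.log ((1 - lam) * Real.exp (t * s.2) + lam * Real.exp (t * f j s.1))
  (s.1 - α • (Real.exp (t * f i s.1 - t * r) • gradient (f i) s.1), r)

/-- The state after `n` passes of the loop, started at `θ₁` with the exact tilted risk as estimate.
Pass number `k = 1, 2, …` uses the step size `α k` and the samples `ζ k` (gradient) and
`ξ k` (estimate). -/
def run {d N : ℕ} (f : Fin N → EuclideanSpace ℝ (Fin d) → ℝ) (t lam : ℝ) (α : ℕ → ℝ)
    (θ₁ : EuclideanSpace ℝ (Fin d)) (ζ ξ : ℕ → Fin N) : ℕ → EuclideanSpace ℝ (Fin d) × ℝ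
  | 0 => (θ₁, tiltedRisk f t θ₁)
  | n + 1 => step f t lam (α (n + 1)) (ζ (n + 1)) (ξ (n + 1)) (run f t lam α θ₁ ζ ξ n)

/-- The `k`-th iterate `θ_k`, for `k = 1, 2, …`: the parameter after `k - 1` passes, so that
`θ_{k+1}` is obtained from `θ_k` in pass `k`. (The unused index `0` also gives `θ₁`.) -/
def iterate {d N : ℕ} (f : Fin N → EuclideanSpace ℝ (Fin d) → ℝ) (t lam : ℝ) (α : ℕ → ℝ)
    (θ₁ : EuclideanSpace ℝ (Fin d)) (ζ ξ : ℕ → Fin N) (k : ℕ) : EuclideanSpace ℝ (Fin d) :=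
  (run f t lam α θ₁ ζ ξ (k - 1)).1

/-- The burn-in `k_t`: the largest integer `k ≥ 1` with
`k < 4e/μ + 4e t L B exp (t (Fmax - Fmin)) / (μ k)`, and `0` if there is none. -/
def burnIn (t μ L B Fmin Fmax : ℝ) : ℕ :=
  sSup {k : ℕ | 1 ≤ k ∧ (k : ℝ) < 4 * Real.exp 1 / μ +
    4 * Real.exp 1 * t * L * B * Real.exp (t * (Fmax - Fmin)) / (μ * k)}

/-- The averaging weight `λ = 1 - 1/(2e)` of the solver. -/
def avgWeight : ℝ := 1 - 1 / (2 * Real.exp 1)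

/-- The step sizes of the solver: constant during the burn-in, then `4e/(μ k)`. -/
def stepSize (t μ L B Fmin Fmax : ℝ) (k : ℕ) : ℝ :=
  if k < burnIn t μ L B Fmin Fmax then
    1 / (t * L * B * Real.exp (t * (Fmax - Fmin)) + 1)
  else 4 * Real.exp 1 / (μ * k)

/-- The (random) iterates `θ_k` of the solver with its parameters inserted. -/
def solver {Ω : Type*} {d N : ℕ} (f : Fin N → EuclideanSpace ℝ (Fin d) → ℝ)
    (t μ L B Fmin Fmax : ℝ) (θ₁ : EuclideanSpace ℝ (Fin d)) (ζ ξ : ℕ → Ω → Fin N)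
    (k : ℕ) (ω : Ω) : EuclideanSpace ℝ (Fin d) :=
  iterate f t avgWeight (stepSize t μ L B Fmin Fmax) θ₁ (fun n => ζ n ω) (fun n => ξ n ω) k

end

end TERM

/-! Let `D n` be the expected suboptimality after `n` passes, `δ` the suboptimality itself, `q = exp
(t Δ)`, and `u` the ratio of `exp (t r)` for the updated estimate `r` to `exp (t R)` for the tilted
risk `R`. A pass moves along `α u⁻¹` times an unbiased stochastic gradient of `R`, independent of
`u` given the past. Smoothness and the PL inequality of `R` (`tiltedRisk_PL`) give `D (n+1) ≤ D n -
α μ W n + (β/2) α² q² B²` with `W = E[u⁻¹ δ]` (`gap_succ_le`).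

The crude bound `W ≥ D/q` suffices only for `q ≤ 2e`. For larger `q`, the tangent bound `u⁻¹ ≥ 1 -
u/4` reduces the task to bounding `A = E[u δ]` from above. Since `exp (t r)` is a moving average of
unbiased samples, `A` forgets its past: while a pass changes `t R` by at most 1, the old value
enters with factor `(1 - λ) e = 1/2` (`weightedGap_succ_le`). Hence `A ≤ 2 D + O(q α B²)`
(`correlation_le`), so `W ≥ D/2 - O(q α B²)`, and the contraction `2e/k` beats the noise
(`rate_succ`).

Outside this regime the bound is cheap: for small `k` because `V ≥ 29 B²/μ`, and for large drift
because `V/k ≥ 2Δ`. All this needs `β ≥ μ/2`; otherwise `R` is constant on `Θ`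
(`IsSmoothOn.eq_of_lt`). -/

namespace TERM

/-! ### Real sequences: from the coupled recursions to the `1/k` rate. -/

section Recursion

/-- The correlation of the weights with the suboptimality forgets its past geometrically:
if `A - 2 D` halves in each step up to an error, it is eventually of the size of the error. -/
theorem correlation_le {D A α : ℕ → ℝ} {μ B q t lam a : ℝ} {n : ℕ}
    (hn : 28 ≤ n) (hμ : 0 < μ) (hq : 1 ≤ q) (ht : 0 < t)
    (hlam : lam ≤ 1)
    (hα : ∀ j, 1 ≤ j → α j ≤ 4 * Real.exp 1 / (μ * j))
    (ha : a = 4 * Real.exp 1 / (μ * ((n : ℝ) + 1)))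
    (hD0 : ∀ n, 0 ≤ D n) (hDB : ∀ n, D n ≤ B ^ 2 / μ)
    (hAq : ∀ n, A n ≤ q * D n)
    (hA : ∀ n, t * (α (n + 1) * q * B ^ 2) ≤ 1 →
      A (n + 1) ≤ 1 / 2 * (A n + α (n + 1) * B ^ 2) + lam * D (n + 1))
    (hback : ∀ n, D n ≤ D (n + 1) + α (n + 1) * q * B ^ 2)
    (hdrift : 2 * t * (a * q * B ^ 2) ≤ 1) :
    A n - 2 * D n ≤ 7 * (q * a * B ^ 2) := by
  have he : 0 < Real.exp 1 := Real.exp_pos 1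
  have he1 : 1 ≤ Real.exp 1 := Real.one_le_exp (by norm_num)
  have ha0 : 0 < a := by rw [ha]; positivity
  have hB2 : 0 ≤ B ^ 2 := sq_nonneg B
  -- Only the second half of the passes is used: there the steps are within a factor 2 of `a`,
  -- whence the 2 in `hdrift`.
  have hα2 : ∀ j, n / 2 ≤ j → α (j + 1) ≤ 2 * a := by
    intro j hj
    refine (hα (j + 1) (by omega)).trans ?_
    have h1 : (n : ℝ) + 1 ≤ 2 * ((j + 1 : ℕ) : ℝ) := by
      have : n + 1 ≤ 2 * (j + 1) := by omega
      exact_mod_cast this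
    have h0 : (0 : ℝ) < ((j + 1 : ℕ) : ℝ) := by positivity
    rw [ha, ← mul_div_assoc, div_le_div_iff₀ (by positivity) (by positivity)]
    have := mul_le_mul_of_nonneg_left h1 (by positivity : 0 ≤ 4 * Real.exp 1 * μ)
    nlinarith
  -- Each step adds at most `α q B² + α B²/2 ≤ 3 q a B²`, and 6 is the fixed point of `x ↦ x/2 + 3`.
  have hrec : ∀ i, A (n / 2 + i) - 2 * D (n / 2 + i) ≤
      (1 / 2) ^ i * (q * (B ^ 2 / μ)) + 6 * (q * a * B ^ 2) := by
    intro i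
    induction i with
    | zero =>
      have h1 := hAq (n / 2)
      have h2 := mul_le_mul_of_nonneg_left (hDB (n / 2)) (by linarith : 0 ≤ q)
      have h3 := hD0 (n / 2)
      have h4 : 0 ≤ q * a * B ^ 2 := by positivity
      simp only [add_zero, pow_zero, one_mul]
      linarith
    | succ i ih =>
      set j := n / 2 + i with hj
      have hαj := hα2 j (by omega)
      have h1 : α (j + 1) * B ^ 2 ≤ 2 * (a * B ^ 2) := by
        nlinarith [mul_le_mul_of_nonneg_right hαj hB2]
      have h2 : α (j + 1) * q * B ^ 2 ≤ 2 * (q * a * B ^ 2) := by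
        nlinarith [mul_le_mul_of_nonneg_right h1 (by linarith : 0 ≤ q)]
      have h3 : a * B ^ 2 ≤ q * a * B ^ 2 := by
        have : 0 ≤ a * B ^ 2 := by positivity
        nlinarith
      have h4 := hA j (by nlinarith [mul_le_mul_of_nonneg_left h2 ht.le])
      have h5 := hback j
      have h6 : lam * D (j + 1) ≤ D (j + 1) := by nlinarith [hD0 (j + 1)]
      rw [← add_assoc, pow_succ]
      nlinarith
  have hfin := hrec (n - n / 2)
  rw [show n / 2 + (n - n / 2) = n by omega] at hfin
  -- With `m = n - n/2` one has `n + 1 ≤ 2m + 1 ≤ 2^m`, so the initial value decays to the size of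
  -- one error term.
  have hpow : ((n : ℝ) + 1) ≤ 2 ^ (n - n / 2) := by
    have key : ∀ m : ℕ, 3 ≤ m → 2 * m + 1 ≤ 2 ^ m := by
      intro m hm
      induction m, hm using Nat.le_induction with
      | base => norm_num
      | succ m hm ih => rw [pow_succ]; omega
    have := key (n - n / 2) (by omega)
    have h' : n + 1 ≤ 2 ^ (n - n / 2) := by omega
    exact_mod_cast h'
  have hsmall : (1 / 2 : ℝ) ^ (n - n / 2) * (q * (B ^ 2 / μ)) ≤ q * a * B ^ 2 := by
    have h1 : (1 / 2 : ℝ) ^ (n - n / 2) ≤ 1 / ((n : ℝ) + 1) := by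
      rw [div_pow, one_pow]
      exact one_div_le_one_div_of_le (by positivity) hpow
    calc (1 / 2 : ℝ) ^ (n - n / 2) * (q * (B ^ 2 / μ))
        ≤ 1 / ((n : ℝ) + 1) * (q * (B ^ 2 / μ)) := by gcongr
      _ = q * (1 / (μ * ((n : ℝ) + 1))) * B ^ 2 := by field_simp
      _ ≤ q * a * B ^ 2 := by
        rw [ha]
        gcongr
        linarith
  linarith

/-- The noise constant dominates the largest possible suboptimality `B ^ 2 / μ`. -/
theorem le_noise_const {μ B q β : ℝ} (hμ : 0 < μ) (hβ : μ / 2 ≤ β) (hq : 1 ≤ q) :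
    29 * (B ^ 2 / μ) ≤ 8 * β * B ^ 2 * (q ^ 2 * Real.exp 1 ^ 2) / μ ^ 2 := by
  have he1 : 2.7182818283 < Real.exp 1 := Real.exp_one_gt_d9
  have hq2 : 1 ≤ q ^ 2 := one_le_pow₀ hq
  -- `8 · (1/2) · 7.25 = 29`; this is the source of the threshold 28 in `rate_succ`.
  have he2 : 7.25 ≤ Real.exp 1 ^ 2 := by nlinarith
  have hβ0 : 0 ≤ 8 * β * B ^ 2 := by
    have : 0 ≤ β := by linarith
    positivity
  calc 29 * (B ^ 2 / μ) = 8 * (μ / 2) * B ^ 2 * (1 * 7.25) / μ ^ 2 := by field_simp; ring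
    _ ≤ _ := by gcongr

/-- If a step can change the risk substantially, the noise exceeds the range `Δ` of the risk. -/
theorem two_mul_range_le {t Δ q a B : ℝ} (ht : 0 < t) (hΔ : 0 ≤ Δ)
    (hqdef : q = Real.exp (t * Δ)) (hdrift : 1 < 2 * t * (a * q * B ^ 2)) :
    2 * Δ ≤ Real.exp 1 * q ^ 2 * a * B ^ 2 := by
  have he1 : 2.7182818283 < Real.exp 1 := Real.exp_one_gt_d9
  have hq0 : 0 < q := by rw [hqdef]; positivity
  have htΔ : 0 ≤ t * Δ := by positivity
  -- The tangent of `exp` at 1: `e x ≤ exp x`.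
  have h3 : Real.exp 1 * (t * Δ) ≤ q := by
    rw [hqdef]
    have h4 : Real.exp (t * Δ) = Real.exp (t * Δ - 1) * Real.exp 1 := by
      rw [← Real.exp_add]; ring_nf
    rw [h4, mul_comm]
    exact mul_le_mul_of_nonneg_right (by linarith [Real.add_one_le_exp (t * Δ - 1)])
      (Real.exp_pos 1).le
  have h6 : Real.exp 1 * q * 1 ≤ Real.exp 1 * q * (2 * t * (a * q * B ^ 2)) := by gcongr
  have h7 : Real.exp 1 * (Real.exp 1 * (t * Δ)) ≤ Real.exp 1 * q := by gcongr
  have h9 : 4 ≤ Real.exp 1 * Real.exp 1 := by nlinarith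
  have h8 : 4 * (t * Δ) ≤ Real.exp 1 * Real.exp 1 * (t * Δ) := by gcongr
  have h10 : 2 * t * (2 * Δ) ≤ 2 * t * (Real.exp 1 * q ^ 2 * a * B ^ 2) := by linarith
  exact le_of_mul_le_mul_left h10 (by positivity)

/-- One step of the `1/k` rate. -/
theorem rate_succ {D A W α : ℕ → ℝ} {μ B q t lam Δ β V : ℝ} {n : ℕ}
    (hμ : 0 < μ) (ht : 0 < t) (hqdef : q = Real.exp (t * Δ)) (hΔ : 0 ≤ Δ)
    (hlam : lam ≤ 1) (hβ : μ / 2 ≤ β)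
    (hα : ∀ j, 1 ≤ j → α j ≤ 4 * Real.exp 1 / (μ * j))
    (hαn : α (n + 1) = 4 * Real.exp 1 / (μ * ((n : ℝ) + 1)))
    (hD0 : ∀ n, 0 ≤ D n) (hDB : ∀ n, D n ≤ B ^ 2 / μ) (hDΔ : ∀ n, D n ≤ Δ)
    (hdesc : D (n + 1) ≤ D n - α (n + 1) * (μ * W n) + β / 2 * α (n + 1) ^ 2 * (q ^ 2 * B ^ 2))
    (hWq : D n / q ≤ W n) (hWA : D n - A n / 4 ≤ W n)
    (hAq : ∀ n, A n ≤ q * D n)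
    (hA : ∀ n, t * (α (n + 1) * q * B ^ 2) ≤ 1 →
      A (n + 1) ≤ 1 / 2 * (A n + α (n + 1) * B ^ 2) + lam * D (n + 1))
    (hback : ∀ n, D n ≤ D (n + 1) + α (n + 1) * q * B ^ 2)
    (hV : 8 * β * B ^ 2 * (q ^ 2 * Real.exp 1 ^ 2) / μ ^ 2 ≤ V)
    (hDn : D n ≤ V / ((n : ℝ) + 1)) :
    D (n + 1) ≤ V / ((n : ℝ) + 2) := by
  have he1 : 2.7182818283 < Real.exp 1 := Real.exp_one_gt_d9
  have hq1 : 1 ≤ q := by rw [hqdef]; exact Real.one_le_exp (by positivity)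
  have hB2 : 0 ≤ B ^ 2 := sq_nonneg B
  set a := α (n + 1) with hadef
  set k : ℝ := (n : ℝ) + 1 with hk
  have hk0 : 0 < k := by positivity
  have ha0 : 0 < a := by rw [hαn]; positivity
  have haμ : a * μ = 4 * Real.exp 1 / k := by rw [hαn]; field_simp
  have hnoise : β / 2 * a ^ 2 * (q ^ 2 * B ^ 2) ≤ V / k ^ 2 := by
    calc β / 2 * a ^ 2 * (q ^ 2 * B ^ 2)
        = (8 * β * B ^ 2 * (q ^ 2 * Real.exp 1 ^ 2) / μ ^ 2) / k ^ 2 := by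
          rw [hαn]; field_simp; ring
      _ ≤ V / k ^ 2 := by gcongr
  have hnoise_lb : μ / 4 * a ^ 2 * (q ^ 2 * B ^ 2) ≤ V / k ^ 2 := by
    refine le_trans ?_ hnoise
    have : μ / 4 ≤ β / 2 := by linarith
    gcongr
  have hV0 : 0 ≤ V := by
    refine le_trans ?_ hV
    have : 0 ≤ β := by linarith
    positivity
  have hk2 : (n : ℝ) + 2 = k + 1 := by rw [hk]; ring
  rw [hk2]
  -- Here `n + 2 ≤ 29`, so `D ≤ B²/μ ≤ V/29` is enough.
  by_cases hn : n < 28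
  · have h1 : (n : ℝ) + 1 ≤ 28 := by exact_mod_cast hn
    rw [le_div_iff₀ (by positivity)]
    have h2 : 29 * (B ^ 2 / μ) ≤ V := (le_noise_const hμ hβ hq1).trans hV
    have h3 := hDB (n + 1)
    have h4 := hD0 (n + 1)
    nlinarith
  push Not at hn
  have hk29 : 29 ≤ k := by
    have : (28 : ℝ) ≤ n := by exact_mod_cast hn
    rw [hk]; linarith
  have hlast : V / k - V / k ^ 2 ≤ V / (k + 1) := by
    have : V / (k + 1) - (V / k - V / k ^ 2) = V / (k ^ 2 * (k + 1)) := by field_simp; ring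
    have h' : 0 ≤ V / (k ^ 2 * (k + 1)) := by positivity
    linarith
  -- For large drift, `D ≤ Δ ≤ V/(2k) ≤ V/(k+1)`.
  by_cases hdrift : 2 * t * (a * q * B ^ 2) ≤ 1
  swap
  · push Not at hdrift
    refine (hDΔ (n + 1)).trans ?_
    have h1 : Real.exp 1 * q ^ 2 * a * B ^ 2 ≤ V / k := by
      have h2 : Real.exp 1 * q ^ 2 * a * B ^ 2 = (μ / 4 * a ^ 2 * (q ^ 2 * B ^ 2)) * k := by
        have : Real.exp 1 = a * μ * k / 4 := by rw [haμ]; field_simp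
        rw [this]; ring
      have : V / k = (V / k ^ 2) * k := by field_simp
      rw [h2, this]
      exact mul_le_mul_of_nonneg_right hnoise_lb hk0.le
    have h5 := (two_mul_range_le ht hΔ hqdef hdrift).trans h1
    rw [le_div_iff₀ hk0] at h5
    rw [le_div_iff₀ (by positivity)]
    nlinarith
  -- `a μ = 4e/k`, so `W ≥ D/(2e)` contracts by `1 - 2/k`; one of the two `V/k²` gained pays for the
  -- noise.
  by_cases hq : q ≤ 2 * Real.exp 1
  · have h1 : D n / (2 * Real.exp 1) ≤ W n := le_trans (by gcongr; exact hD0 n) hWq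
    have h2 : 2 / k * D n ≤ a * (μ * W n) := by
      calc 2 / k * D n = a * μ * (D n / (2 * Real.exp 1)) := by
            rw [haμ]; field_simp; ring
        _ ≤ a * μ * W n := by gcongr
        _ = _ := by ring
    have h3 : (1 - 2 / k) * D n ≤ (1 - 2 / k) * (V / k) := by
      gcongr
      rw [sub_nonneg, div_le_one hk0]; linarith
    have h4 : (1 - 2 / k) * (V / k) = V / k - 2 * (V / k ^ 2) := by field_simp
    linarith
  -- Now `W ≥ D/2 - (7/4) q a B²` contracts by `1 - 2e/k`. The correlation error costs `(7/5) V/k²`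
  -- (using `q ≥ 5`) and the noise `V/k²`, in total less than `(2e - 1) V/k²`.
  · push Not at hq
    have hX := correlation_le (a := a) hn hμ hq1 ht hlam hα hαn hD0 hDB hAq hA hback hdrift
    have h1 : D n / 2 - 7 / 4 * (q * a * B ^ 2) ≤ W n := by linarith
    have h2 : a * μ * (D n / 2 - 7 / 4 * (q * a * B ^ 2)) ≤ a * (μ * W n) := by
      rw [← mul_assoc a μ (W n)]
      exact mul_le_mul_of_nonneg_left h1 (by positivity)
    rw [mul_sub] at h2
    have h3 : a * μ * (7 / 4 * (q * a * B ^ 2)) ≤ 7 / 5 * (V / k ^ 2) := by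
      refine le_trans ?_ (mul_le_mul_of_nonneg_left hnoise_lb (by norm_num))
      have h5 : 5 ≤ q := by linarith
      have h6 : 0 ≤ μ * a ^ 2 * q * B ^ 2 := by positivity
      nlinarith
    have h4 : a * μ * (D n / 2) = 2 * Real.exp 1 / k * D n := by rw [haμ]; field_simp; ring
    have he3 : Real.exp 1 < 2.7182818286 := Real.exp_one_lt_d9
    have h5 : (1 - 2 * Real.exp 1 / k) * D n ≤ (1 - 2 * Real.exp 1 / k) * (V / k) := by
      gcongr
      rw [sub_nonneg, div_le_one hk0]; linarith
    have h6 : (1 - 2 * Real.exp 1 / k) * (V / k) = V / k - 2 * Real.exp 1 * (V / k ^ 2) := by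
      field_simp
    have h7 : 2.7 * (V / k ^ 2) ≤ Real.exp 1 * (V / k ^ 2) := by
      gcongr
      linarith
    have h8 : 0 ≤ V / k ^ 2 := by positivity
    linarith

/-- The `1/k` rate from the burn-in `K` on. -/
theorem rate {D A W α : ℕ → ℝ} {μ B q t lam Δ β V : ℝ} {K : ℕ}
    (hμ : 0 < μ) (ht : 0 < t) (hqdef : q = Real.exp (t * Δ)) (hΔ : 0 ≤ Δ)
    (hlam : lam ≤ 1) (hβ : μ / 2 ≤ β)
    (hα : ∀ j, 1 ≤ j → α j ≤ 4 * Real.exp 1 / (μ * j))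
    (hαK : ∀ j, K ≤ j → α j = 4 * Real.exp 1 / (μ * j))
    (hD0 : ∀ n, 0 ≤ D n) (hDB : ∀ n, D n ≤ B ^ 2 / μ) (hDΔ : ∀ n, D n ≤ Δ)
    (hdesc : ∀ n, D (n + 1) ≤
      D n - α (n + 1) * (μ * W n) + β / 2 * α (n + 1) ^ 2 * (q ^ 2 * B ^ 2))
    (hWq : ∀ n, D n / q ≤ W n) (hWA : ∀ n, D n - A n / 4 ≤ W n)
    (hAq : ∀ n, A n ≤ q * D n)
    (hA : ∀ n, t * (α (n + 1) * q * B ^ 2) ≤ 1 →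
      A (n + 1) ≤ 1 / 2 * (A n + α (n + 1) * B ^ 2) + lam * D (n + 1))
    (hback : ∀ n, D n ≤ D (n + 1) + α (n + 1) * q * B ^ 2)
    (hV : 8 * β * B ^ 2 * (q ^ 2 * Real.exp 1 ^ 2) / μ ^ 2 ≤ V)
    (hVK : K * D (K - 1) ≤ V) (k : ℕ) (hk : K ≤ k) :
    D k ≤ V / ((k : ℝ) + 1) := by
  have hstep : ∀ n, K ≤ n + 1 → D n ≤ V / ((n : ℝ) + 1) →
      D (n + 1) ≤ V / ((n : ℝ) + 2) := fun n hn h =>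
    rate_succ hμ ht hqdef hΔ hlam hβ hα (by rw [hαK _ hn]; push_cast; rfl) hD0 hDB hDΔ (hdesc n)
      (hWq n) (hWA n) hAq hA hback hV h
  induction k, hk using Nat.le_induction with
  | base =>
    cases K with
    | zero =>
      have hq1 : 1 ≤ q := by rw [hqdef]; exact Real.one_le_exp (by positivity)
      have h0 : 0 ≤ B ^ 2 / μ := by positivity
      have h2 : 29 * (B ^ 2 / μ) ≤ V := (le_noise_const hμ hβ hq1).trans hV
      have h3 := hDB 0
      simp only [Nat.cast_zero, zero_add, div_one]
      linarith
    | succ n =>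
      -- `hVK` is the claimed bound one index before `K`, so the base case is itself one step of the
      -- recursion.
      have h1 := hstep n le_rfl (by
        rw [le_div_iff₀ (by positivity)]
        simp only [Nat.cast_add, Nat.cast_one, Nat.add_sub_cancel] at hVK
        linarith)
      convert h1 using 2
      push_cast; ring
  | succ k hk ih =>
    convert hstep k (by omega) ih using 2
    push_cast; ring

end Recursion

/-! ### Burn-in and step sizes. -/

section StepSize

variable {t μ L B Fmin Fmax : ℝ}

theorem stepSize_of_le {k : ℕ} (hk : burnIn t μ L B Fmin Fmax ≤ k) :
    stepSize t μ L B Fmin Fmax k = 4 * Real.exp 1 / (μ * k) := by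
  rw [stepSize, if_neg (by omega)]

theorem stepSize_nonneg (ht : 0 < t) (hμ : 0 < μ) (hL : 0 ≤ L) (hB : 0 ≤ B) (k : ℕ) :
    0 ≤ stepSize t μ L B Fmin Fmax k := by
  rw [stepSize]
  split_ifs <;> positivity

/-- A supremum in `ℕ` is attained for nonempty bounded sets: positivity excludes the default value 0
at the empty set, and `k ≥ 1` bounds the right-hand side. -/
theorem burnIn_mem (ht : 0 < t) (hμ : 0 < μ) (hL : 0 ≤ L) (hB : 0 ≤ B)
    (h : 0 < burnIn t μ L B Fmin Fmax) :
    (burnIn t μ L B Fmin Fmax : ℝ) < 4 * Real.exp 1 / μ + 4 * Real.exp 1 * t * L * B *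
      Real.exp (t * (Fmax - Fmin)) / (μ * burnIn t μ L B Fmin Fmax) := by
  set S := {k : ℕ | 1 ≤ k ∧ (k : ℝ) < 4 * Real.exp 1 / μ +
    4 * Real.exp 1 * t * L * B * Real.exp (t * (Fmax - Fmin)) / (μ * k)} with hS
  have hne : S.Nonempty := by
    by_contra hne
    rw [Set.not_nonempty_iff_eq_empty] at hne
    have h0 : burnIn t μ L B Fmin Fmax = sSup S := rfl
    rw [h0, hne, csSup_empty] at h
    exact lt_irrefl _ h
  have hbdd : BddAbove S := by
    refine ⟨⌈4 * Real.exp 1 / μ + 4 * Real.exp 1 * t * L * B *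
      Real.exp (t * (Fmax - Fmin)) / μ⌉₊, ?_⟩
    rintro k ⟨hk1, hk⟩
    have hk1' : (1 : ℝ) ≤ k := by exact_mod_cast hk1
    have : (k : ℝ) ≤ _ := hk.le.trans ((add_le_add_right (div_le_div_of_nonneg_left (by positivity)
      hμ (le_mul_of_one_le_right hμ.le hk1')) _).trans (Nat.le_ceil _))
    exact_mod_cast this
  exact (Nat.sSup_mem hne hbdd).2

/-- The constant step of the burn-in obeys the later formula too: the inequality defining `K =
burnIn` gives `j < K < (4e/μ)(T + 1)`. -/
theorem stepSize_le (ht : 0 < t) (hμ : 0 < μ) (hL : 0 ≤ L) (hB : 0 ≤ B) (j : ℕ) (hj : 1 ≤ j) :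
    stepSize t μ L B Fmin Fmax j ≤ 4 * Real.exp 1 / (μ * j) := by
  by_cases h : j < burnIn t μ L B Fmin Fmax
  swap
  · exact (stepSize_of_le (by omega)).le
  rw [stepSize, if_pos h]
  have hmem := burnIn_mem (Fmin := Fmin) (Fmax := Fmax) ht hμ hL hB (by omega)
  set K := burnIn t μ L B Fmin Fmax
  have hj1 : (1 : ℝ) ≤ j := by exact_mod_cast hj
  have hjK : (j : ℝ) ≤ K := by exact_mod_cast h.le
  set T := t * L * B * Real.exp (t * (Fmax - Fmin)) with hT
  have hT0 : 0 ≤ T := by positivity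
  have h1 : (j : ℝ) < 4 * Real.exp 1 / μ * (T + 1) := by
    have : 4 * Real.exp 1 / μ + 4 * Real.exp 1 * t * L * B *
        Real.exp (t * (Fmax - Fmin)) / (μ * K) ≤ 4 * Real.exp 1 / μ * (T + 1) := by
      calc _ = 4 * Real.exp 1 / μ + 4 * Real.exp 1 * T / (μ * K) := by rw [hT]; ring_nf
        _ ≤ 4 * Real.exp 1 / μ + 4 * Real.exp 1 * T / μ := by
          gcongr
          exact le_mul_of_one_le_right hμ.le (hj1.trans hjK)
        _ = _ := by ring
    linarith
  rw [div_le_div_iff₀ (by positivity) (by positivity)]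
  rw [div_mul_eq_mul_div, lt_div_iff₀ hμ] at h1
  linarith

end StepSize

/-! ### Smooth functions on open sets, and PL constants exceeding the smoothness. -/

section Smooth

variable {d : ℕ} {g : EuclideanSpace ℝ (Fin d) → ℝ} {Θ : Set (EuclideanSpace ℝ (Fin d))}

/-- The descent lemma along a segment in the domain. -/
theorem IsSmoothOn.le_quadratic {β : ℝ≥0} (hg : IsSmoothOn β g Θ) (hΘ : IsOpen Θ)
    {x y : EuclideanSpace ℝ (Fin d)} (hxy : segment ℝ x y ⊆ Θ) :
    g y ≤ g x + inner ℝ (gradient g x) (y - x) + β / 2 * ‖y - x‖ ^ 2 := by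
  have hmem : ∀ s ∈ Set.Icc (0 : ℝ) 1, x + s • (y - x) ∈ Θ := by
    intro s hs
    apply hxy
    rw [segment_eq_image']
    exact ⟨s, hs, rfl⟩
  have hx : x ∈ Θ := hxy (left_mem_segment ℝ x y)
  -- `g` along the segment minus its quadratic majorant, up to a constant; Cauchy-Schwarz and the
  -- Lipschitz gradient make it antitone.
  set φ : ℝ → ℝ := fun s =>
    g (x + s • (y - x)) - s * inner ℝ (gradient g x) (y - x) - β / 2 * s ^ 2 * ‖y - x‖ ^ 2 with hφ
  have hderiv : ∀ s ∈ Set.Icc (0 : ℝ) 1, HasDerivAt φ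
      (inner ℝ (gradient g (x + s • (y - x))) (y - x) - inner ℝ (gradient g x) (y - x)
        - β * s * ‖y - x‖ ^ 2) s := by
    intro s hs
    have h1 : HasFDerivAt g (InnerProductSpace.toDual ℝ _ (gradient g (x + s • (y - x))))
        (x + s • (y - x)) :=
      ((hg.1.differentiableAt (hΘ.mem_nhds (hmem s hs))).hasGradientAt).hasFDerivAt
    have h2 : HasDerivAt (fun s : ℝ => x + s • (y - x)) (y - x) s := by
      simpa using ((hasDerivAt_id s).smul_const (y - x)).const_add x
    have h3 := h1.comp_hasDerivAt s h2
    have h4 : HasDerivAt (fun s : ℝ => s * inner ℝ (gradient g x) (y - x))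
        (inner ℝ (gradient g x) (y - x)) s := by
      simpa using (hasDerivAt_id s).mul_const (inner ℝ (gradient g x) (y - x))
    have h5 : HasDerivAt (fun s : ℝ => β / 2 * s ^ 2 * ‖y - x‖ ^ 2) (β * s * ‖y - x‖ ^ 2) s := by
      refine (((hasDerivAt_pow 2 s).const_mul ((β : ℝ) / 2)).mul_const (‖y - x‖ ^ 2)).congr_deriv ?_
      simp only [Nat.cast_ofNat, Nat.add_one_sub_one, pow_one]
      ring
    exact (h3.sub h4).sub h5
  have hanti : AntitoneOn φ (Set.Icc 0 1) := by
    apply antitoneOn_of_deriv_nonpos (convex_Icc 0 1)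
    · exact fun s hs => (hderiv s hs).continuousAt.continuousWithinAt
    · intro s hs
      rw [interior_Icc] at hs
      exact (hderiv s (Set.Ioo_subset_Icc_self hs)).differentiableAt.differentiableWithinAt
    · intro s hs
      rw [interior_Icc] at hs
      have hs' := Set.Ioo_subset_Icc_self hs
      rw [(hderiv s hs').deriv, ← inner_sub_left]
      have h1 := real_inner_le_norm (gradient g (x + s • (y - x)) - gradient g x) (y - x)
      have h2 := hg.2.norm_sub_le (hmem s hs') hx
      rw [add_sub_cancel_left, norm_smul, Real.norm_of_nonneg hs'.1] at h2
      have h3 := mul_le_mul_of_nonneg_right h2 (norm_nonneg (y - x))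
      nlinarith
  have h := hanti (Set.left_mem_Icc.2 zero_le_one) (Set.right_mem_Icc.2 zero_le_one) zero_le_one
  simp only [hφ, one_smul, zero_smul, add_zero, add_sub_cancel, one_pow, zero_mul, one_mul,
    mul_one, sub_zero, ne_eq, OfNat.ofNat_ne_zero, not_false_eq_true, zero_pow, mul_zero] at h
  linarith

/-- A bound on the gradient bounds the increments along a segment in the domain. -/
theorem abs_sub_le_of_norm_gradient_le {C : ℝ} (hg : DifferentiableOn ℝ g Θ) (hΘ : IsOpen Θ)
    (hC : ∀ z ∈ Θ, ‖gradient g z‖ ≤ C) {x y : EuclideanSpace ℝ (Fin d)}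
    (hxy : segment ℝ x y ⊆ Θ) : |g y - g x| ≤ C * ‖y - x‖ := by
  refine (convex_segment x y).norm_image_sub_le_of_norm_fderiv_le (𝕜 := ℝ)
    (fun z hz => hg.differentiableAt (hΘ.mem_nhds (hxy hz))) (fun z hz => ?_)
    (left_mem_segment ℝ x y) (right_mem_segment ℝ x y)
  have h := hC z (hxy hz)
  rwa [gradient, LinearIsometryEquiv.norm_map] at h

/-- A smooth function satisfying a Polyak-Łojasiewicz inequality with a constant exceeding the
smoothness is constant on a connected domain in which it attains its minimum. -/
theorem IsSmoothOn.eq_of_lt {β : ℝ≥0} {μ : ℝ} (hg : IsSmoothOn β g Θ) (hΘ : IsOpen Θ)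
    (hconn : IsPreconnected Θ) {m : EuclideanSpace ℝ (Fin d)} (hm : m ∈ Θ) (hmin : IsMinOn g Θ m)
    (hμ : 0 < μ) (hPL : ∀ x ∈ Θ, μ * (g x - g m) ≤ ‖gradient g x‖ ^ 2) (hβ : (β : ℝ) < μ / 2) :
    ∀ x ∈ Θ, g x = g m := by
  have hcont : ContinuousOn g Θ := hg.1.continuousOn
  set u : Set (EuclideanSpace ℝ (Fin d)) := Θ ∩ g ⁻¹' {g m}ᶜ with hu
  have hu_open : IsOpen u := hcont.isOpen_inter_preimage hΘ isOpen_compl_singleton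
  set v : Set (EuclideanSpace ℝ (Fin d)) := interior (Θ ∩ g ⁻¹' {g m}) with hv
  -- The set of minimizers is open; it is also relatively closed, so connectedness makes it all of
  -- `Θ`.
  have hlocal : ∀ z ∈ Θ, g z = g m → z ∈ v := by
    intro z hz hzm
    rw [hv, mem_interior_iff_mem_nhds]
    obtain ⟨ε, hε, hball⟩ := Metric.isOpen_iff.1 hΘ z hz
    have hgrad : gradient g z = 0 := by
      have : IsLocalMin g z := by
        filter_upwards [hΘ.mem_nhds hz] with x hx
        rw [hzm]; exact hmin hx
      rw [gradient, this.fderiv_eq_zero, map_zero]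
    refine Filter.mem_of_superset (Metric.ball_mem_nhds z (half_pos hε)) fun x hx => ?_
    have hxΘ : x ∈ Θ := hball (Metric.ball_subset_ball (by linarith) hx)
    refine ⟨hxΘ, ?_⟩
    have hge : g m ≤ g x := hmin hxΘ
    have hlip : ‖gradient g x‖ ≤ β * ‖x - z‖ := by
      simpa [hgrad] using hg.2.norm_sub_le hxΘ hz
    have hPLx := hPL x hxΘ
    refine le_antisymm ?_ hge
    by_contra hlt
    push Not at hlt
    have hpos : 0 < μ * (g x - g m) := mul_pos hμ (by linarith)
    rcases eq_or_lt_of_le β.coe_nonneg with hβ0 | hβ0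
    · rw [← hβ0, zero_mul] at hlip
      have : ‖gradient g x‖ = 0 := le_antisymm hlip (norm_nonneg _)
      rw [this] at hPLx
      linarith
    -- Since `∇g z = 0`, the gradient step of length `1/β` is no longer than `‖x - z‖` and stays in
    -- the ball. It would decrease `g` by `‖∇g x‖²/(2β)`, more than the gap that PL allows.
    set y := x - (β : ℝ)⁻¹ • gradient g x with hy
    have hyx : y - x = -((β : ℝ)⁻¹ • gradient g x) := by rw [hy]; abel
    have hnorm : ‖y - x‖ = (β : ℝ)⁻¹ * ‖gradient g x‖ := by
      rw [hyx, norm_neg, norm_smul, Real.norm_of_nonneg (by positivity)]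
    have hxz : ‖x - z‖ < ε / 2 := by rwa [Metric.mem_ball, dist_eq_norm] at hx
    have hyz : y ∈ Metric.ball z ε := by
      rw [Metric.mem_ball, dist_eq_norm]
      have h1 : ‖y - x‖ ≤ ‖x - z‖ := by
        rw [hnorm, inv_mul_le_iff₀ hβ0]; exact hlip
      have h2 : ‖y - z‖ ≤ ‖y - x‖ + ‖x - z‖ := norm_sub_le_norm_sub_add_norm_sub y x z
      linarith
    have hseg : segment ℝ x y ⊆ Θ := ((convex_ball z ε).segment_subset
      (Metric.ball_subset_ball (by linarith) hx) hyz).trans hball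
    have hdesc := hg.le_quadratic hΘ hseg
    have hmy : g m ≤ g y := hmin (hball hyz)
    rw [hnorm, hyx, inner_neg_right, inner_smul_right, real_inner_self_eq_norm_sq] at hdesc
    have h3 : -((β : ℝ)⁻¹ * ‖gradient g x‖ ^ 2) + β / 2 * ((β : ℝ)⁻¹ * ‖gradient g x‖) ^ 2
        = -(‖gradient g x‖ ^ 2 / (2 * β)) := by field_simp; ring
    have h4 : g x - g m < ‖gradient g x‖ ^ 2 / (2 * β) := by
      rw [lt_div_iff₀ (by positivity)]
      nlinarith
    linarith
  have hv_open : IsOpen v := isOpen_interior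
  have hdisj : Disjoint u v := by
    rw [Set.disjoint_left]
    rintro x hxu hxv
    exact hxu.2 (interior_subset hxv).2
  have hcover : Θ ⊆ u ∪ v := by
    intro x hx
    by_cases h : g x = g m
    · exact Or.inr (hlocal x hx h)
    · exact Or.inl ⟨hx, h⟩
  have hsub := hconn.subset_right_of_subset_union hu_open hv_open hdisj hcover
    ⟨m, hm, hlocal m hm rfl⟩
  exact fun x hx => (interior_subset (hsub hx)).2

end Smooth

/-! ### Gradient and PL inequality of the tilted risk. -/

section TiltedRisk

variable {d N : ℕ} {f : Fin N → EuclideanSpace ℝ (Fin d) → ℝ} {t : ℝ}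
  {Θ : Set (EuclideanSpace ℝ (Fin d))}

theorem exp_tiltedRisk (hN : 0 < N) (ht : 0 < t) (θ : EuclideanSpace ℝ (Fin d)) :
    Real.exp (t * tiltedRisk f t θ) = (1 / (N : ℝ)) * ∑ i, Real.exp (t * f i θ) := by
  have : Nonempty (Fin N) := ⟨⟨0, hN⟩⟩
  have hN' : (0 : ℝ) < N := by exact_mod_cast hN
  rw [tiltedRisk, ← mul_assoc, mul_one_div_cancel ht.ne', one_mul, Real.exp_log]
  exact mul_pos (by positivity) (Finset.sum_pos (fun i _ => Real.exp_pos _) Finset.univ_nonempty)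

theorem tiltedRisk_mem (hN : 0 < N) (ht : 0 < t) {θ : EuclideanSpace ℝ (Fin d)} {a b : ℝ}
    (h : ∀ i, a ≤ f i θ ∧ f i θ ≤ b) : a ≤ tiltedRisk f t θ ∧ tiltedRisk f t θ ≤ b := by
  have hN' : (0 : ℝ) < N := by exact_mod_cast hN
  have hcard : ∀ c : ℝ, (1 / (N : ℝ)) * ∑ _i : Fin N, c = c := by
    intro c
    rw [Finset.sum_const, Finset.card_univ, Fintype.card_fin, nsmul_eq_mul]
    field_simp
  have key := exp_tiltedRisk (f := f) hN ht θ
  constructor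
  · have : Real.exp (t * a) ≤ Real.exp (t * tiltedRisk f t θ) := by
      rw [key, ← hcard (Real.exp (t * a))]
      gcongr with i
      exact (h i).1
    exact le_of_mul_le_mul_left (Real.exp_le_exp.1 this) ht
  · have : Real.exp (t * tiltedRisk f t θ) ≤ Real.exp (t * b) := by
      rw [key, ← hcard (Real.exp (t * b))]
      gcongr with i
      exact (h i).2
    exact le_of_mul_le_mul_left (Real.exp_le_exp.1 this) ht

theorem hasGradientAt_tiltedRisk (hN : 0 < N) (ht : 0 < t) {θ : EuclideanSpace ℝ (Fin d)}
    (hf : ∀ i, DifferentiableAt ℝ (f i) θ) :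
    HasGradientAt (tiltedRisk f t) ((1 / (N : ℝ)) • ∑ i, tiltedStochGrad f t i θ) θ := by
  have hN' : (0 : ℝ) < N := by exact_mod_cast hN
  have key := exp_tiltedRisk (f := f) hN ht θ
  have h1 : HasFDerivAt (fun θ => (1 / (N : ℝ)) * ∑ i, Real.exp (t * f i θ))
      ((1 / (N : ℝ)) • ∑ i, Real.exp (t * f i θ) •
        (t • InnerProductSpace.toDual ℝ _ (gradient (f i) θ))) θ :=
    (HasFDerivAt.fun_sum fun i _ => ((hf i).hasGradientAt.hasFDerivAt.const_mul t).exp).const_mul _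
  have hpos : (1 / (N : ℝ)) * ∑ i, Real.exp (t * f i θ) ≠ 0 := by
    rw [← key]; exact (Real.exp_pos _).ne'
  have h2 := (h1.log hpos).const_mul (1 / t)
  rw [hasGradientAt_iff_hasFDerivAt]
  refine h2.congr_fderiv ?_
  rw [← key]
  ext v
  simp only [tiltedStochGrad, smul_apply, sum_apply,
    InnerProductSpace.toDual_apply_apply, inner_smul_left, sum_inner, smul_eq_mul, Finset.mul_sum,
    map_div₀, conj_trivial]
  refine Finset.sum_congr rfl fun i _ => ?_
  field_simp

theorem norm_gradient_tiltedRisk_le (hN : 0 < N) (ht : 0 < t) {θ : EuclideanSpace ℝ (Fin d)}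
    (hf : ∀ i, DifferentiableAt ℝ (f i) θ) {B : ℝ} (hB : ∀ i, ‖tiltedStochGrad f t i θ‖ ≤ B) :
    ‖gradient (tiltedRisk f t) θ‖ ≤ B := by
  have hN' : (0 : ℝ) < N := by exact_mod_cast hN
  rw [(hasGradientAt_tiltedRisk hN ht hf).gradient, norm_smul, Real.norm_of_nonneg (by positivity)]
  have h1 : ‖∑ i, tiltedStochGrad f t i θ‖ ≤ N * B := by
    refine (norm_sum_le _ _).trans ((Finset.sum_le_sum fun i _ => hB i).trans ?_)
    simp
  calc 1 / (N : ℝ) * ‖∑ i, tiltedStochGrad f t i θ‖ ≤ 1 / (N : ℝ) * (N * B) := by gcongr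
    _ = B := by field_simp

/-- The tilted risk inherits the Polyak-Łojasiewicz inequality from the mixtures of the losses. -/
theorem tiltedRisk_PL (hN : 0 < N) (ht : 0 < t) {μ : ℝ} {θ θ' : EuclideanSpace ℝ (Fin d)}
    (hθ : θ ∈ Θ) (hθ' : θ' ∈ Θ) (hμ : 0 < μ) (hf : ∀ i, DifferentiableAt ℝ (f i) θ)
    (hPL : ∀ p ∈ stdSimplex ℝ (Fin N), IsPLOn (μ / 2) (fun θ => ∑ i, p i * f i θ) Θ) :
    μ * (tiltedRisk f t θ - tiltedRisk f t θ') ≤ ‖gradient (tiltedRisk f t) θ‖ ^ 2 := by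
  have hN' : (0 : ℝ) < N := by exact_mod_cast hN
  set R := tiltedRisk f t with hR
  -- The tilted weights at `θ`: the mixture they define has the same gradient as `R` at this point.
  set p : Fin N → ℝ := fun i => (1 / (N : ℝ)) * (Real.exp (t * f i θ) / Real.exp (t * R θ)) with hp
  have hp0 : ∀ i, 0 ≤ p i := fun i => by rw [hp]; positivity
  have hp1 : ∑ i, p i = 1 := by
    rw [hp, ← Finset.mul_sum, ← Finset.sum_div, ← mul_div_assoc,
      ← exp_tiltedRisk (f := f) hN ht θ]
    exact div_self (Real.exp_pos _).ne'
  have hgrad : gradient (fun θ => ∑ i, p i * f i θ) θ = gradient R θ := by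
    rw [(hasGradientAt_tiltedRisk hN ht hf).gradient]
    apply HasGradientAt.gradient
    rw [hasGradientAt_iff_hasFDerivAt]
    have h1 : HasFDerivAt (fun θ => ∑ i, p i * f i θ)
        (∑ i, p i • InnerProductSpace.toDual ℝ _ (gradient (f i) θ)) θ :=
      HasFDerivAt.fun_sum fun i _ => (hf i).hasGradientAt.hasFDerivAt.const_mul (p i)
    refine h1.congr_fderiv ?_
    ext v
    simp only [tiltedStochGrad, smul_apply, sum_apply,
      InnerProductSpace.toDual_apply_apply, inner_smul_left, sum_inner, smul_eq_mul,
      Finset.mul_sum, hp, conj_trivial, mul_assoc, hR]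
  have hpl := hPL p ⟨hp0, hp1⟩ θ hθ θ' hθ'
  rw [hgrad] at hpl
  -- Jensen for `exp`, because `exp (t (R θ' - R θ)) = ∑ p i exp (t (f i θ' - f i θ))`.
  have hjensen : R θ - R θ' ≤ ∑ i, p i * f i θ - ∑ i, p i * f i θ' := by
    have h1 : Real.exp (∑ i, p i * (t * (f i θ' - f i θ))) ≤ Real.exp (t * (R θ' - R θ)) := by
      have h2 := convexOn_exp.map_sum_le (t := Finset.univ) (w := p)
        (p := fun i => t * (f i θ' - f i θ)) (fun i _ => hp0 i) hp1 (fun i _ => Set.mem_univ _)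
      simp only [smul_eq_mul] at h2
      refine h2.trans (le_of_eq ?_)
      rw [mul_sub t (R θ') (R θ), Real.exp_sub, exp_tiltedRisk (f := f) hN ht θ', mul_div_assoc,
        Finset.sum_div, Finset.mul_sum]
      refine Finset.sum_congr rfl fun i _ => ?_
      rw [hp, mul_sub, Real.exp_sub]
      field_simp
    have h3 := Real.exp_le_exp.1 h1
    have h4 : ∑ i, p i * (t * (f i θ' - f i θ)) =
        t * (∑ i, p i * f i θ' - ∑ i, p i * f i θ) := by
      rw [← Finset.sum_sub_distrib, Finset.mul_sum]
      exact Finset.sum_congr rfl fun i _ => by ring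
    rw [h4] at h3
    have := le_of_mul_le_mul_left h3 ht
    linarith
  have := mul_le_mul_of_nonneg_left hjensen hμ.le
  linarith

end TiltedRisk

/-! ### Independence and averaging over fresh samples. -/

section Sampling

variable {Ω : Type*} {d N : ℕ}
  {f : Fin N → EuclideanSpace ℝ (Fin d) → ℝ} {t lam : ℝ} {α : ℕ → ℝ}
  {θ₁ : EuclideanSpace ℝ (Fin d)}

/-- The state after `n` passes depends only on the samples of these passes. -/
theorem run_congr {ζ ζ' ξ ξ' : ℕ → Fin N} {n : ℕ}
    (hζ : ∀ m ∈ Finset.Icc 1 n, ζ m = ζ' m) (hξ : ∀ m ∈ Finset.Icc 1 n, ξ m = ξ' m) :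
    run f t lam α θ₁ ζ ξ n = run f t lam α θ₁ ζ' ξ' n := by
  induction n with
  | zero => rfl
  | succ n ih =>
    have hsub : Finset.Icc 1 n ⊆ Finset.Icc 1 (n + 1) := Finset.Icc_subset_Icc_right n.le_succ
    have hmem : n + 1 ∈ Finset.Icc 1 (n + 1) := by simp
    rw [run, run, ih (fun m hm => hζ m (hsub hm)) (fun m hm => hξ m (hsub hm)), hζ _ hmem,
      hξ _ hmem]

/-- The state after `n` passes is a function of the finite tuple of samples of these passes. -/
theorem exists_run_eq (hN : 0 < N) (f : Fin N → EuclideanSpace ℝ (Fin d) → ℝ) (t lam : ℝ)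
    (α : ℕ → ℝ) (θ₁ : EuclideanSpace ℝ (Fin d)) (n : ℕ) :
    ∃ Φ : ((Finset.Icc 1 n).disjSum (Finset.Icc 1 n) → Fin N) → EuclideanSpace ℝ (Fin d) × ℝ,
      ∀ ζ ξ : ℕ → Fin N, run f t lam α θ₁ ζ ξ n = Φ fun c => Sum.elim ζ ξ c.1 := by
  classical
  let ext (c : (Finset.Icc 1 n).disjSum (Finset.Icc 1 n) → Fin N) (s : ℕ ⊕ ℕ) : Fin N :=
    if h : s ∈ (Finset.Icc 1 n).disjSum (Finset.Icc 1 n) then c ⟨s, h⟩ else ⟨0, hN⟩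
  refine ⟨fun c => run f t lam α θ₁ (fun m => ext c (Sum.inl m)) (fun m => ext c (Sum.inr m)) n,
    fun ζ ξ => run_congr (fun m hm => ?_) (fun m hm => ?_)⟩
  · have h : Sum.inl m ∈ (Finset.Icc 1 n).disjSum (Finset.Icc 1 n) := Finset.inl_mem_disjSum.2 hm
    simp only [ext, dif_pos h, Sum.elim_inl]
  · have h : Sum.inr m ∈ (Finset.Icc 1 n).disjSum (Finset.Icc 1 n) := Finset.inr_mem_disjSum.2 hm
    simp only [ext, dif_pos h, Sum.elim_inr]

/-- The run up to a given pass is a function of finitely many `Fin N`-valued samples, so no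
measurability of the losses or gradients is required. -/
theorem integrable_comp_of_finite {S : Type*} [MeasurableSpace Ω] {P : Measure Ω}
    [IsProbabilityMeasure P] [Finite S] [MeasurableSpace S] [MeasurableSingletonClass S]
    {Y : Ω → S} (hY : Measurable Y) (ψ : S → ℝ) : Integrable (fun ω => ψ (Y ω)) P :=
  (Integrable.of_finite (f := ψ) (μ := P.map Y)).comp_measurable hY

variable [MeasurableSpace Ω] {P : Measure Ω} [IsProbabilityMeasure P] {ζ ξ : ℕ → Ω → Fin N}

theorem measurable_sample (hζ : ∀ k, Measurable (ζ k)) (hξ : ∀ k, Measurable (ξ k))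
    (s : ℕ ⊕ ℕ) : Measurable (Sum.elim ζ ξ s) := by
  cases s with
  | inl k => exact hζ k
  | inr k => exact hξ k

theorem integrable_run (hN : 0 < N) (hζ : ∀ k, Measurable (ζ k)) (hξ : ∀ k, Measurable (ξ k))
    (H : EuclideanSpace ℝ (Fin d) × ℝ → ℝ) (n : ℕ) :
    Integrable (fun ω => H (run f t lam α θ₁ (fun k => ζ k ω) (fun k => ξ k ω) n)) P := by
  obtain ⟨Φ, hΦ⟩ := exists_run_eq hN f t lam α θ₁ n
  have hY : Measurable fun (ω : Ω) (c : (Finset.Icc 1 n).disjSum (Finset.Icc 1 n)) =>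
      Sum.elim ζ ξ c.1 ω := measurable_pi_lambda _ fun c => measurable_sample hζ hξ c.1
  convert integrable_comp_of_finite (P := P) hY (fun c => H (Φ c)) using 3 with ω
  rw [hΦ]
  congr 1
  ext c
  rcases c with ⟨c | c, hc⟩ <;> rfl

/-- The expectation over the fresh samples of the next pass is an average. -/
theorem integral_next (hN : 0 < N) (hζ : ∀ k, Measurable (ζ k)) (hξ : ∀ k, Measurable (ξ k))
    (hindep : iIndepFun (Sum.elim ζ ξ) P)
    (hζ_unif : ∀ k i, P.real (ζ k ⁻¹' {i}) = 1 / (N : ℝ))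
    (hξ_unif : ∀ k i, P.real (ξ k ⁻¹' {i}) = 1 / (N : ℝ))
    (H : EuclideanSpace ℝ (Fin d) × ℝ → Fin N → Fin N → ℝ) (n : ℕ) :
    Integrable (fun ω => H (run f t lam α θ₁ (fun k => ζ k ω) (fun k => ξ k ω) n)
      (ζ (n + 1) ω) (ξ (n + 1) ω)) P ∧
    ∫ ω, H (run f t lam α θ₁ (fun k => ζ k ω) (fun k => ξ k ω) n)
      (ζ (n + 1) ω) (ξ (n + 1) ω) ∂P =
    ∫ ω, (1 / (N : ℝ)) * ∑ i, (1 / (N : ℝ)) * ∑ j,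
      H (run f t lam α θ₁ (fun k => ζ k ω) (fun k => ξ k ω) n) i j ∂P := by
  classical
  let S := (Finset.Icc 1 n).disjSum (Finset.Icc 1 n)
  obtain ⟨Φ, hΦ⟩ : ∃ Φ : (S → Fin N) → EuclideanSpace ℝ (Fin d) × ℝ, ∀ ζ ξ : ℕ → Fin N,
    run f t lam α θ₁ ζ ξ n = Φ fun c => Sum.elim ζ ξ c.1 := exists_run_eq hN f t lam α θ₁ n
  set T : Finset (ℕ ⊕ ℕ) := {Sum.inl (n + 1), Sum.inr (n + 1)} with hT
  have hX := measurable_sample hζ hξ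
  set Y : Ω → S → Fin N := fun ω c => Sum.elim ζ ξ c.1 ω with hYdef
  set Z : Ω → T → Fin N := fun ω c => Sum.elim ζ ξ c.1 ω with hZdef
  have hY : Measurable Y := measurable_pi_lambda _ fun c => hX c.1
  have hZ : Measurable Z := measurable_pi_lambda _ fun c => hX c.1
  have hST : Disjoint S T := by
    rw [Finset.disjoint_left]
    intro s hs hs'
    rw [hT, Finset.mem_insert, Finset.mem_singleton] at hs'
    rcases hs' with rfl | rfl
    · have := Finset.inl_mem_disjSum.1 hs
      simp at this
    · have := Finset.inr_mem_disjSum.1 hs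
      simp at this
  have hYZ : IndepFun Y Z P := hindep.indepFun_finset S T hST hX
  have hrun : ∀ ω, run f t lam α θ₁ (fun k => ζ k ω) (fun k => ξ k ω) n = Φ (Y ω) := by
    intro ω
    rw [hΦ]
    congr 1
    ext c
    rcases c with ⟨c | c, hc⟩ <;> rfl
  have hl : Sum.inl (n + 1) ∈ T := by simp [hT]
  have hr : Sum.inr (n + 1) ∈ T := by simp [hT]
  have hζZ : ∀ ω, ζ (n + 1) ω = Z ω ⟨_, hl⟩ := fun ω => rfl
  have hξZ : ∀ ω, ξ (n + 1) ω = Z ω ⟨_, hr⟩ := fun ω => rfl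
  simp only [hrun]
  constructor
  · exact integrable_comp_of_finite (hY.prodMk hZ)
      (fun y => H (Φ y.1) (y.2 ⟨_, hl⟩) (y.2 ⟨_, hr⟩))
  -- Splitting by the values of the fresh samples writes the integrand as a sum of products (past) ×
  -- (fresh), to which independence applies.
  let ind (i j : Fin N) (z : T → Fin N) : ℝ :=
    if z ⟨_, hl⟩ = i ∧ z ⟨_, hr⟩ = j then 1 else 0
  have hprob : ∀ i j, ∫ ω, ind i j (Z ω) ∂P = 1 / (N : ℝ) * (1 / (N : ℝ)) := by
    intro i j
    have hpair : IndepFun (ζ (n + 1)) (ξ (n + 1)) P :=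
      hindep.indepFun (i := Sum.inl (n + 1)) (j := Sum.inr (n + 1)) (by simp)
    have hmeas : MeasurableSet (ζ (n + 1) ⁻¹' {i} ∩ ξ (n + 1) ⁻¹' {j}) :=
      (hζ _ (measurableSet_singleton i)).inter (hξ _ (measurableSet_singleton j))
    have h1 : (fun ω => ind i j (Z ω)) =
        (ζ (n + 1) ⁻¹' {i} ∩ ξ (n + 1) ⁻¹' {j}).indicator 1 := by
      funext ω
      simp only [ind, ← hζZ, ← hξZ, Set.indicator_apply, Set.mem_inter_iff, Set.mem_preimage,
        Set.mem_singleton_iff, Pi.one_apply]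
    rw [h1, integral_indicator_one hmeas, measureReal_def,
      hpair.measure_inter_preimage_eq_mul _ _ (measurableSet_singleton i)
        (measurableSet_singleton j), ENNReal.toReal_mul]
    rw [← measureReal_def, ← measureReal_def, hζ_unif, hξ_unif]
  have hint : ∀ i j, Integrable (fun ω => H (Φ (Y ω)) i j * ind i j (Z ω)) P := fun i j =>
    integrable_comp_of_finite (hY.prodMk hZ) (fun y => H (Φ y.1) i j * ind i j y.2)
  have hdecomp : ∀ ω, H (Φ (Y ω)) (ζ (n + 1) ω) (ξ (n + 1) ω) =
      ∑ i, ∑ j, H (Φ (Y ω)) i j * ind i j (Z ω) := by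
    intro ω
    rw [Finset.sum_eq_single (ζ (n + 1) ω), Finset.sum_eq_single (ξ (n + 1) ω)]
    · simp [ind, hζZ, hξZ]
    · intro j _ hj
      simp [ind, ← hξZ, hj.symm]
    · simp
    · intro i _ hi
      simp [ind, ← hζZ, hi.symm]
    · simp
  have hprod : ∀ i j, ∫ ω, H (Φ (Y ω)) i j * ind i j (Z ω) ∂P =
      ∫ ω, (1 / (N : ℝ)) * ((1 / (N : ℝ)) * H (Φ (Y ω)) i j) ∂P := by
    intro i j
    rw [hYZ.integral_fun_comp_mul_comp (f := fun y => H (Φ y) i j) (g := ind i j)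
      hY.aemeasurable hZ.aemeasurable
      .of_discrete .of_discrete,
      hprob, integral_const_mul, integral_const_mul]
    ring
  simp only [hdecomp, Finset.mul_sum]
  rw [integral_finsetSum _ fun i _ => integrable_finsetSum _ fun j _ => hint i j,
    integral_finsetSum]
  · refine Finset.sum_congr rfl fun i _ => ?_
    rw [integral_finsetSum _ fun j _ => hint i j, integral_finsetSum]
    · exact Finset.sum_congr rfl fun j _ => hprod i j
    · exact fun j _ => integrable_comp_of_finite hY
        (fun y => (1 / (N : ℝ)) * ((1 / (N : ℝ)) * H (Φ y) i j))
  · exact fun i _ => integrable_comp_of_finite hY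
      (fun y => ∑ j, (1 / (N : ℝ)) * ((1 / (N : ℝ)) * H (Φ y) i j))

end Sampling

/-! ### One pass in terms of the ratio of estimate to risk. -/

section Step

variable {d N : ℕ} {f : Fin N → EuclideanSpace ℝ (Fin d) → ℝ} {t : ℝ}

theorem one_sub_avgWeight : 1 - avgWeight = 1 / (2 * Real.exp 1) := by
  rw [avgWeight]; ring

theorem one_sub_avgWeight_pos : 0 < 1 - avgWeight := by
  rw [one_sub_avgWeight]; positivity

theorem avgWeight_le_one : avgWeight ≤ 1 := by linarith [one_sub_avgWeight_pos]

theorem avgWeight_pos : 0 < avgWeight := by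
  have h : 1 < 2 * Real.exp 1 := by linarith [Real.exp_one_gt_d9]
  have : 1 / (2 * Real.exp 1) < 1 := by
    rw [div_lt_one (by positivity)]; exact h
  rw [avgWeight]; linarith

/-- The ratio `exp (t r) / exp (t R(t;θ))` of the updated estimate to the tilted risk, where the
estimate is updated in state `s` with the sample `j`. -/
noncomputable def estRatio (f : Fin N → EuclideanSpace ℝ (Fin d) → ℝ) (t : ℝ)
    (s : EuclideanSpace ℝ (Fin d) × ℝ) (j : Fin N) : ℝ :=
  ((1 - avgWeight) * Real.exp (t * s.2) + avgWeight * Real.exp (t * f j s.1)) /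
    Real.exp (t * tiltedRisk f t s.1)

theorem average_pos (a b : ℝ) :
    0 < (1 - avgWeight) * Real.exp a + avgWeight * Real.exp b := by
  have := one_sub_avgWeight_pos
  have := avgWeight_pos
  positivity

theorem estRatio_pos (s : EuclideanSpace ℝ (Fin d) × ℝ) (j : Fin N) : 0 < estRatio f t s j :=
  div_pos (average_pos _ _) (Real.exp_pos _)

theorem exp_step_snd (ht : 0 < t) (a : ℝ) (i j : Fin N) (s : EuclideanSpace ℝ (Fin d) × ℝ) :
    Real.exp (t * (step f t avgWeight a i j s).2) =
      (1 - avgWeight) * Real.exp (t * s.2) + avgWeight * Real.exp (t * f j s.1) := by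
  simp only [step]
  rw [← mul_assoc, mul_one_div_cancel ht.ne', one_mul, Real.exp_log (average_pos _ _)]

/-- The estimate affects the step only through the scalar `estRatio`. -/
theorem step_fst_sub (ht : 0 < t) (a : ℝ) (i j : Fin N) (s : EuclideanSpace ℝ (Fin d) × ℝ) :
    (step f t avgWeight a i j s).1 - s.1 =
      -((a * (estRatio f t s j)⁻¹) • tiltedStochGrad f t i s.1) := by
  have h1 : (step f t avgWeight a i j s).1 = s.1 - a • (Real.exp (t * f i s.1 -
      t * (step f t avgWeight a i j s).2) • gradient (f i) s.1) := rfl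
  rw [h1, sub_sub_cancel_left, Real.exp_sub, exp_step_snd ht, tiltedStochGrad, estRatio, smul_smul,
    smul_smul]
  congr 2
  have := (average_pos (t * s.2) (t * f j s.1)).ne'
  field_simp

/-- The memory of the estimate: moving to the new parameter multiplies the ratio by the exponential
of the risk drift. -/
theorem exp_step_ratio (ht : 0 < t) (a : ℝ) (i j : Fin N) (s : EuclideanSpace ℝ (Fin d) × ℝ) :
    Real.exp (t * ((step f t avgWeight a i j s).2 -
      tiltedRisk f t (step f t avgWeight a i j s).1)) =
    estRatio f t s j *
      Real.exp (t * (tiltedRisk f t s.1 - tiltedRisk f t (step f t avgWeight a i j s).1)) := by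
  rw [mul_sub, Real.exp_sub, exp_step_snd ht, mul_sub, Real.exp_sub, estRatio]
  field_simp

/-- The average of `exp (t f_j)` is exactly `exp (t R)`, so the fresh sample contributes `λ`
independently of the state. -/
theorem average_estRatio (hN : 0 < N) (ht : 0 < t) (s : EuclideanSpace ℝ (Fin d) × ℝ) :
    (1 / (N : ℝ)) * ∑ j, estRatio f t s j =
      (1 - avgWeight) * Real.exp (t * (s.2 - tiltedRisk f t s.1)) + avgWeight := by
  have hN' : (0 : ℝ) < N := by exact_mod_cast hN
  have key := exp_tiltedRisk (f := f) hN ht s.1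
  simp only [estRatio]
  rw [← Finset.sum_div, Finset.sum_add_distrib, ← Finset.mul_sum, ← Finset.mul_sum,
    Finset.sum_const, Finset.card_univ, Fintype.card_fin, nsmul_eq_mul, mul_sub, Real.exp_sub]
  have h : ∑ j, Real.exp (t * f j s.1) = N * Real.exp (t * tiltedRisk f t s.1) := by
    rw [key]; field_simp
  rw [h]
  field_simp

theorem average_mem {t r x a b : ℝ} (ht : 0 < t) (hr : a ≤ r ∧ r ≤ b) (hx : a ≤ x ∧ x ≤ b) :
    Real.exp (t * a) ≤ (1 - avgWeight) * Real.exp (t * r) + avgWeight * Real.exp (t * x) ∧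
      (1 - avgWeight) * Real.exp (t * r) + avgWeight * Real.exp (t * x) ≤ Real.exp (t * b) := by
  have h1 := one_sub_avgWeight_pos.le
  have h2 := avgWeight_pos.le
  have mono : ∀ {y z : ℝ}, y ≤ z → Real.exp (t * y) ≤ Real.exp (t * z) := fun h =>
    Real.exp_le_exp.2 (mul_le_mul_of_nonneg_left h ht.le)
  constructor
  · linarith [mul_le_mul_of_nonneg_left (mono hr.1) h1, mul_le_mul_of_nonneg_left (mono hx.1) h2]
  · linarith [mul_le_mul_of_nonneg_left (mono hr.2) h1, mul_le_mul_of_nonneg_left (mono hx.2) h2]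

theorem step_snd_mem (ht : 0 < t) {a b : ℝ} {s : EuclideanSpace ℝ (Fin d) × ℝ}
    (hs : a ≤ s.2 ∧ s.2 ≤ b) (hf : ∀ i, a ≤ f i s.1 ∧ f i s.1 ≤ b) (c : ℝ) (i j : Fin N) :
    a ≤ (step f t avgWeight c i j s).2 ∧ (step f t avgWeight c i j s).2 ≤ b := by
  have h := average_mem ht hs (hf j)
  rw [← exp_step_snd ht c i j s] at h
  exact ⟨le_of_mul_le_mul_left (Real.exp_le_exp.1 h.1) ht,
    le_of_mul_le_mul_left (Real.exp_le_exp.1 h.2) ht⟩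

theorem estRatio_mem (hN : 0 < N) (ht : 0 < t) {a b : ℝ} {s : EuclideanSpace ℝ (Fin d) × ℝ}
    (hs : a ≤ s.2 ∧ s.2 ≤ b) (hf : ∀ i, a ≤ f i s.1 ∧ f i s.1 ≤ b) (j : Fin N) :
    (estRatio f t s j)⁻¹ ≤ Real.exp (t * (b - a)) ∧ estRatio f t s j ≤ Real.exp (t * (b - a)) := by
  have h := average_mem ht hs (hf j)
  have hR := tiltedRisk_mem hN ht hf
  have h1 : Real.exp (t * a) ≤ Real.exp (t * tiltedRisk f t s.1) :=
    Real.exp_le_exp.2 (mul_le_mul_of_nonneg_left hR.1 ht.le)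
  have h2 : Real.exp (t * tiltedRisk f t s.1) ≤ Real.exp (t * b) :=
    Real.exp_le_exp.2 (mul_le_mul_of_nonneg_left hR.2 ht.le)
  rw [mul_sub, Real.exp_sub, estRatio, inv_div]
  exact ⟨div_le_div₀ (Real.exp_pos _).le h2 (Real.exp_pos _) h.1,
    div_le_div₀ (Real.exp_pos _).le h.2 (Real.exp_pos _) h1⟩

end Step

/-! ### Expected descent and the recursion of the correlation. -/

section Estimates

variable {Ω : Type*} {d N : ℕ} {f : Fin N → EuclideanSpace ℝ (Fin d) → ℝ}
  {Θ : Set (EuclideanSpace ℝ (Fin d))}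
  {t μ B Fmin Fmax : ℝ} {β : ℝ≥0} {θ₁ θopt : EuclideanSpace ℝ (Fin d)} {α : ℕ → ℝ}
  {ζ ξ : ℕ → Ω → Fin N}

/-- The random state after `n` passes. -/
noncomputable def state (f : Fin N → EuclideanSpace ℝ (Fin d) → ℝ) (t : ℝ) (α : ℕ → ℝ)
    (θ₁ : EuclideanSpace ℝ (Fin d)) (ζ ξ : ℕ → Ω → Fin N) (n : ℕ) (ω : Ω) :
    EuclideanSpace ℝ (Fin d) × ℝ :=
  run f t avgWeight α θ₁ (fun k => ζ k ω) (fun k => ξ k ω) n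

/-- The run stays in the domain and the estimates stay in the range of the losses. -/
def Admissible (f : Fin N → EuclideanSpace ℝ (Fin d) → ℝ) (Θ : Set (EuclideanSpace ℝ (Fin d)))
    (t Fmin Fmax : ℝ) (α : ℕ → ℝ) (θ₁ : EuclideanSpace ℝ (Fin d)) (ζ ξ : ℕ → Ω → Fin N)
    (ω : Ω) : Prop :=
  ∀ n, segment ℝ (state f t α θ₁ ζ ξ n ω).1 (state f t α θ₁ ζ ξ (n + 1) ω).1 ⊆ Θ ∧
    Fmin ≤ (state f t α θ₁ ζ ξ n ω).2 ∧ (state f t α θ₁ ζ ξ n ω).2 ≤ Fmax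

theorem Admissible.mem {ω : Ω} (h : Admissible f Θ t Fmin Fmax α θ₁ ζ ξ ω) (n : ℕ) :
    (state f t α θ₁ ζ ξ n ω).1 ∈ Θ :=
  (h n).1 (left_mem_segment ℝ _ _)

theorem admissible_of_segment (hN : 0 < N) (ht : 0 < t)
    (hf : ∀ i, ∀ θ ∈ Θ, Fmin ≤ f i θ ∧ f i θ ≤ Fmax) {ω : Ω}
    (h : ∀ n, segment ℝ (state f t α θ₁ ζ ξ n ω).1 (state f t α θ₁ ζ ξ (n + 1) ω).1 ⊆ Θ) :
    Admissible f Θ t Fmin Fmax α θ₁ ζ ξ ω := by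
  have hmem : ∀ n, (state f t α θ₁ ζ ξ n ω).1 ∈ Θ := fun n => h n (left_mem_segment ℝ _ _)
  intro n
  refine ⟨h n, ?_⟩
  induction n with
  | zero => exact tiltedRisk_mem hN ht fun i => hf i _ (hmem 0)
  | succ n ih => exact step_snd_mem ht ih (fun i => hf i _ (hmem n)) _ _ _

/-- A step changes the risk by at most the step size, weighted by the inverse ratio. -/
theorem Admissible.abs_sub_le (hN : 0 < N) (ht : 0 < t) (hΘ : IsOpen Θ)
    (hf_diff : ∀ i, DifferentiableOn ℝ (f i) Θ)
    (hR : DifferentiableOn ℝ (tiltedRisk f t) Θ)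
    (hgrad : ∀ i, ∀ θ ∈ Θ, ‖tiltedStochGrad f t i θ‖ ≤ B) (hB : 0 ≤ B) (hα : ∀ n, 0 ≤ α n)
    {ω : Ω} (h : Admissible f Θ t Fmin Fmax α θ₁ ζ ξ ω) (n : ℕ) :
    |tiltedRisk f t (state f t α θ₁ ζ ξ (n + 1) ω).1 -
      tiltedRisk f t (state f t α θ₁ ζ ξ n ω).1| ≤
    α (n + 1) * (estRatio f t (state f t α θ₁ ζ ξ n ω) (ξ (n + 1) ω))⁻¹ * B ^ 2 := by
  have h1 := abs_sub_le_of_norm_gradient_le hR hΘ (C := B) (fun z hz =>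
    norm_gradient_tiltedRisk_le hN ht (fun i => (hf_diff i).differentiableAt (hΘ.mem_nhds hz))
      fun i => hgrad i z hz) (h n).1
  have hsub : (state f t α θ₁ ζ ξ (n + 1) ω).1 - (state f t α θ₁ ζ ξ n ω).1 = _ :=
    step_fst_sub ht (α (n + 1)) (ζ (n + 1) ω) (ξ (n + 1) ω) (state f t α θ₁ ζ ξ n ω)
  have hu := estRatio_pos (f := f) (t := t) (state f t α θ₁ ζ ξ n ω) (ξ (n + 1) ω)
  have hα' := hα (n + 1)
  rw [hsub, norm_neg, norm_smul, Real.norm_of_nonneg (by positivity)] at h1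
  refine h1.trans ?_
  have h2 := hgrad (ζ (n + 1) ω) _ (h.mem n)
  calc _ ≤ B * (α (n + 1) * (estRatio f t (state f t α θ₁ ζ ξ n ω) (ξ (n + 1) ω))⁻¹ * B) := by
        gcongr
    _ = _ := by ring

variable [MeasurableSpace Ω] {P : Measure Ω}

/-- The expected suboptimality after `n` passes, with the suboptimality weighted by a function
of the ratio of the next estimate to the tilted risk. -/
noncomputable def weightedGap (P : Measure Ω) (f : Fin N → EuclideanSpace ℝ (Fin d) → ℝ) (t : ℝ)
    (α : ℕ → ℝ) (θ₁ θopt : EuclideanSpace ℝ (Fin d)) (ζ ξ : ℕ → Ω → Fin N) (φ : ℝ → ℝ) (n : ℕ) :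
    ℝ :=
  ∫ ω, φ (estRatio f t (state f t α θ₁ ζ ξ n ω) (ξ (n + 1) ω)) *
    (tiltedRisk f t (state f t α θ₁ ζ ξ n ω).1 - tiltedRisk f t θopt) ∂P

/-- The expected suboptimality after `n` passes. -/
noncomputable def gap (P : Measure Ω) (f : Fin N → EuclideanSpace ℝ (Fin d) → ℝ) (t : ℝ)
    (α : ℕ → ℝ) (θ₁ θopt : EuclideanSpace ℝ (Fin d)) (ζ ξ : ℕ → Ω → Fin N) (n : ℕ) : ℝ :=
  ∫ ω, (tiltedRisk f t (state f t α θ₁ ζ ξ n ω).1 - tiltedRisk f t θopt) ∂P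

theorem gap_nonneg (hadm : ∀ᵐ ω ∂P, Admissible f Θ t Fmin Fmax α θ₁ ζ ξ ω)
    (hopt : IsMinOn (tiltedRisk f t) Θ θopt) (n : ℕ) : 0 ≤ gap P f t α θ₁ θopt ζ ξ n := by
  refine integral_nonneg_of_ae ?_
  filter_upwards [hadm] with ω hω
  exact sub_nonneg.2 (hopt (hω.mem n))

variable [IsProbabilityMeasure P]

theorem integrable_state (hN : 0 < N) (hζ : ∀ k, Measurable (ζ k)) (hξ : ∀ k, Measurable (ξ k))
    (H : EuclideanSpace ℝ (Fin d) × ℝ → ℝ) (n : ℕ) :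
    Integrable (fun ω => H (state f t α θ₁ ζ ξ n ω)) P :=
  integrable_run hN hζ hξ H n

theorem gap_le_of_forall (hN : 0 < N) (hζ : ∀ k, Measurable (ζ k)) (hξ : ∀ k, Measurable (ξ k))
    (hadm : ∀ᵐ ω ∂P, Admissible f Θ t Fmin Fmax α θ₁ ζ ξ ω) {C : ℝ}
    (hC : ∀ θ ∈ Θ, tiltedRisk f t θ - tiltedRisk f t θopt ≤ C) (n : ℕ) :
    gap P f t α θ₁ θopt ζ ξ n ≤ C := by
  have h : gap P f t α θ₁ θopt ζ ξ n ≤ ∫ _, C ∂P := by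
    refine integral_mono_ae (integrable_state hN hζ hξ
      (fun s => tiltedRisk f t s.1 - tiltedRisk f t θopt) n) (integrable_const C) ?_
    filter_upwards [hadm] with ω hω
    exact hC _ (hω.mem n)
  simpa using h

theorem integrable_weighted (hN : 0 < N) (hζ : ∀ k, Measurable (ζ k)) (hξ : ∀ k, Measurable (ξ k))
    (hindep : iIndepFun (Sum.elim ζ ξ) P)
    (hζ_unif : ∀ k i, P.real (ζ k ⁻¹' {i}) = 1 / (N : ℝ))
    (hξ_unif : ∀ k i, P.real (ξ k ⁻¹' {i}) = 1 / (N : ℝ)) (φ : ℝ → ℝ) (n : ℕ) :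
    Integrable (fun ω => φ (estRatio f t (state f t α θ₁ ζ ξ n ω) (ξ (n + 1) ω)) *
      (tiltedRisk f t (state f t α θ₁ ζ ξ n ω).1 - tiltedRisk f t θopt)) P :=
  (integral_next hN hζ hξ hindep hζ_unif hξ_unif
    (fun s _ j => φ (estRatio f t s j) * (tiltedRisk f t s.1 - tiltedRisk f t θopt)) n).1

theorem average_const (hN : 0 < N) (c : ℝ) : (1 / (N : ℝ)) * ∑ _i : Fin N, c = c := by
  have hN' : (0 : ℝ) < N := by exact_mod_cast hN
  rw [Finset.sum_const, Finset.card_univ, Fintype.card_fin, nsmul_eq_mul]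
  field_simp

/-- The weighted gap after averaging over the fresh samples. -/
theorem weightedGap_eq (hN : 0 < N) (hζ : ∀ k, Measurable (ζ k)) (hξ : ∀ k, Measurable (ξ k))
    (hindep : iIndepFun (Sum.elim ζ ξ) P)
    (hζ_unif : ∀ k i, P.real (ζ k ⁻¹' {i}) = 1 / (N : ℝ))
    (hξ_unif : ∀ k i, P.real (ξ k ⁻¹' {i}) = 1 / (N : ℝ)) (φ : ℝ → ℝ) (n : ℕ) :
    weightedGap P f t α θ₁ θopt ζ ξ φ n =
      ∫ ω, ((1 / (N : ℝ)) * ∑ j, φ (estRatio f t (state f t α θ₁ ζ ξ n ω) j)) *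
        (tiltedRisk f t (state f t α θ₁ ζ ξ n ω).1 - tiltedRisk f t θopt) ∂P := by
  refine ((integral_next hN hζ hξ hindep hζ_unif hξ_unif
    (fun s _ j => φ (estRatio f t s j) * (tiltedRisk f t s.1 - tiltedRisk f t θopt)) n).2).trans ?_
  simp only [average_const hN, ← Finset.sum_mul, ← mul_assoc]
  rfl

/-- A pointwise comparison of weights gives a comparison of weighted gaps. -/
theorem gap_mul_le_weightedGap (hN : 0 < N) (ht : 0 < t) (hζ : ∀ k, Measurable (ζ k))
    (hξ : ∀ k, Measurable (ξ k)) (hindep : iIndepFun (Sum.elim ζ ξ) P)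
    (hζ_unif : ∀ k i, P.real (ζ k ⁻¹' {i}) = 1 / (N : ℝ))
    (hξ_unif : ∀ k i, P.real (ξ k ⁻¹' {i}) = 1 / (N : ℝ))
    (hf : ∀ i, ∀ θ ∈ Θ, Fmin ≤ f i θ ∧ f i θ ≤ Fmax)
    (hadm : ∀ᵐ ω ∂P, Admissible f Θ t Fmin Fmax α θ₁ ζ ξ ω)
    (hopt : IsMinOn (tiltedRisk f t) Θ θopt) {φ : ℝ → ℝ} {c e : ℝ}
    (hφ : ∀ u, 0 < u → u⁻¹ ≤ Real.exp (t * (Fmax - Fmin)) → u ≤ Real.exp (t * (Fmax - Fmin)) →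
      c ≤ φ u + e * u) (n : ℕ) :
    c * gap P f t α θ₁ θopt ζ ξ n ≤
      weightedGap P f t α θ₁ θopt ζ ξ φ n + e * weightedGap P f t α θ₁ θopt ζ ξ id n := by
  have hi := integrable_weighted (f := f) (t := t) (α := α) (θ₁ := θ₁) (θopt := θopt) hN hζ hξ
    hindep hζ_unif hξ_unif (n := n)
  have h1 : weightedGap P f t α θ₁ θopt ζ ξ φ n + e * weightedGap P f t α θ₁ θopt ζ ξ id n =
      ∫ ω, (φ (estRatio f t (state f t α θ₁ ζ ξ n ω) (ξ (n + 1) ω)) *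
          (tiltedRisk f t (state f t α θ₁ ζ ξ n ω).1 - tiltedRisk f t θopt) +
        e * (id (estRatio f t (state f t α θ₁ ζ ξ n ω) (ξ (n + 1) ω)) *
          (tiltedRisk f t (state f t α θ₁ ζ ξ n ω).1 - tiltedRisk f t θopt))) ∂P := by
    rw [integral_add (hi φ) ((hi id).const_mul e), integral_const_mul]
    rfl
  rw [h1, gap, ← integral_const_mul]
  refine integral_mono_ae ((integrable_state hN hζ hξ
      (fun s => tiltedRisk f t s.1 - tiltedRisk f t θopt) n).const_mul c)
    ((hi φ).add ((hi id).const_mul e)) ?_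
  filter_upwards [hadm] with ω hω
  have hu := estRatio_mem hN ht (hω n).2 (fun i => hf i _ (hω.mem n)) (ξ (n + 1) ω)
  have h2 := hφ _ (estRatio_pos _ _) hu.1 hu.2
  have h3 := mul_le_mul_of_nonneg_right h2 (sub_nonneg.2 (hopt (hω.mem n)))
  simp only [id]
  linarith

/-- The gap does not drop too fast. -/
theorem gap_le_succ (hN : 0 < N) (ht : 0 < t) (hΘ : IsOpen Θ)
    (hf_diff : ∀ i, DifferentiableOn ℝ (f i) Θ)
    (hf : ∀ i, ∀ θ ∈ Θ, Fmin ≤ f i θ ∧ f i θ ≤ Fmax)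
    (hR : DifferentiableOn ℝ (tiltedRisk f t) Θ)
    (hgrad : ∀ i, ∀ θ ∈ Θ, ‖tiltedStochGrad f t i θ‖ ≤ B) (hB : 0 ≤ B) (hα : ∀ n, 0 ≤ α n)
    (hζ : ∀ k, Measurable (ζ k)) (hξ : ∀ k, Measurable (ξ k))
    (hadm : ∀ᵐ ω ∂P, Admissible f Θ t Fmin Fmax α θ₁ ζ ξ ω) (n : ℕ) :
    gap P f t α θ₁ θopt ζ ξ n ≤ gap P f t α θ₁ θopt ζ ξ (n + 1) +
      α (n + 1) * Real.exp (t * (Fmax - Fmin)) * B ^ 2 := by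
  have hi := integrable_state (P := P) (f := f) (t := t) (α := α) (θ₁ := θ₁) hN hζ hξ
    (fun s => tiltedRisk f t s.1 - tiltedRisk f t θopt)
  have h1 : gap P f t α θ₁ θopt ζ ξ (n + 1) + α (n + 1) * Real.exp (t * (Fmax - Fmin)) * B ^ 2 =
      ∫ ω, ((tiltedRisk f t (state f t α θ₁ ζ ξ (n + 1) ω).1 - tiltedRisk f t θopt) +
        α (n + 1) * Real.exp (t * (Fmax - Fmin)) * B ^ 2) ∂P := by
    rw [integral_add (hi (n + 1)) (integrable_const _)]
    simp [gap]
  rw [h1, gap]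
  refine integral_mono_ae (hi n) ((hi (n + 1)).add (integrable_const _)) ?_
  filter_upwards [hadm] with ω hω
  have h2 := (abs_le.1 (hω.abs_sub_le hN ht hΘ hf_diff hR hgrad hB hα n)).1
  have hu := (estRatio_mem hN ht (hω n).2 (fun i => hf i _ (hω.mem n)) (ξ (n + 1) ω)).1
  have h3 := mul_le_mul_of_nonneg_right (mul_le_mul_of_nonneg_left hu (hα (n + 1))) (sq_nonneg B)
  linarith

/-- The recursion of the correlation of the ratio with the suboptimality. -/
theorem weightedGap_succ_le (hN : 0 < N) (ht : 0 < t) (hΘ : IsOpen Θ)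
    (hf_diff : ∀ i, DifferentiableOn ℝ (f i) Θ)
    (hf : ∀ i, ∀ θ ∈ Θ, Fmin ≤ f i θ ∧ f i θ ≤ Fmax)
    (hR : DifferentiableOn ℝ (tiltedRisk f t) Θ)
    (hgrad : ∀ i, ∀ θ ∈ Θ, ‖tiltedStochGrad f t i θ‖ ≤ B) (hB : 0 ≤ B) (hα : ∀ n, 0 ≤ α n)
    (hζ : ∀ k, Measurable (ζ k)) (hξ : ∀ k, Measurable (ξ k))
    (hindep : iIndepFun (Sum.elim ζ ξ) P)
    (hζ_unif : ∀ k i, P.real (ζ k ⁻¹' {i}) = 1 / (N : ℝ))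
    (hξ_unif : ∀ k i, P.real (ξ k ⁻¹' {i}) = 1 / (N : ℝ))
    (hadm : ∀ᵐ ω ∂P, Admissible f Θ t Fmin Fmax α θ₁ ζ ξ ω)
    (hopt : IsMinOn (tiltedRisk f t) Θ θopt) (n : ℕ)
    (hdrift : t * (α (n + 1) * Real.exp (t * (Fmax - Fmin)) * B ^ 2) ≤ 1) :
    weightedGap P f t α θ₁ θopt ζ ξ id (n + 1) ≤
      1 / 2 * (weightedGap P f t α θ₁ θopt ζ ξ id n + α (n + 1) * B ^ 2) +
        avgWeight * gap P f t α θ₁ θopt ζ ξ (n + 1) := by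
  have hi := integrable_state (P := P) (f := f) (t := t) (α := α) (θ₁ := θ₁) hN hζ hξ
    (fun s => tiltedRisk f t s.1 - tiltedRisk f t θopt)
  have hw := integrable_weighted (f := f) (t := t) (α := α) (θ₁ := θ₁) (θopt := θopt) hN hζ hξ
    hindep hζ_unif hξ_unif id n
  have hrhs : 1 / 2 * (weightedGap P f t α θ₁ θopt ζ ξ id n + α (n + 1) * B ^ 2) +
        avgWeight * gap P f t α θ₁ θopt ζ ξ (n + 1) =
      ∫ ω, (1 / 2 * (id (estRatio f t (state f t α θ₁ ζ ξ n ω) (ξ (n + 1) ω)) *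
          (tiltedRisk f t (state f t α θ₁ ζ ξ n ω).1 - tiltedRisk f t θopt) + α (n + 1) * B ^ 2) +
        avgWeight * (tiltedRisk f t (state f t α θ₁ ζ ξ (n + 1) ω).1 -
          tiltedRisk f t θopt)) ∂P := by
    rw [integral_add ((hw.fun_add (integrable_const _)).const_mul _) ((hi (n + 1)).const_mul _),
      integral_const_mul, integral_const_mul, integral_add hw (integrable_const _)]
    simp [gap, weightedGap]
  rw [hrhs, weightedGap_eq hN hζ hξ hindep hζ_unif hξ_unif]
  refine integral_mono_ae (integrable_state hN hζ hξ
    (fun s => ((1 / (N : ℝ)) * ∑ j, id (estRatio f t s j)) *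
      (tiltedRisk f t s.1 - tiltedRisk f t θopt)) (n + 1))
    (((hw.add (integrable_const _)).const_mul _).add ((hi (n + 1)).const_mul _)) ?_
  filter_upwards [hadm] with ω hω
  have hstep : Real.exp (t * ((state f t α θ₁ ζ ξ (n + 1) ω).2 -
      tiltedRisk f t (state f t α θ₁ ζ ξ (n + 1) ω).1)) = _ :=
    exp_step_ratio ht (α (n + 1)) (ζ (n + 1) ω) (ξ (n + 1) ω) (state f t α θ₁ ζ ξ n ω)
  simp only [id, average_estRatio hN ht]
  rw [hstep]
  change ((1 - avgWeight) * (_ * Real.exp (t * (tiltedRisk f t (state f t α θ₁ ζ ξ n ω).1 -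
    tiltedRisk f t (state f t α θ₁ ζ ξ (n + 1) ω).1))) + avgWeight) * _ ≤ _
  have habs := abs_le.1 (hω.abs_sub_le hN ht hΘ hf_diff hR hgrad hB hα n)
  have hu := (estRatio_mem hN ht (hω n).2 (fun i => hf i _ (hω.mem n)) (ξ (n + 1) ω)).1
  have hu0 := estRatio_pos (f := f) (t := t) (state f t α θ₁ ζ ξ n ω) (ξ (n + 1) ω)
  have hδ' : 0 ≤ tiltedRisk f t (state f t α θ₁ ζ ξ (n + 1) ω).1 - tiltedRisk f t θopt :=
    sub_nonneg.2 (hopt (hω.mem (n + 1)))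
  set u := estRatio f t (state f t α θ₁ ζ ξ n ω) (ξ (n + 1) ω) with hudef
  set R := tiltedRisk f t (state f t α θ₁ ζ ξ n ω).1
  set R' := tiltedRisk f t (state f t α θ₁ ζ ξ (n + 1) ω).1
  have hexp : Real.exp (t * (R - R')) ≤ Real.exp 1 := by
    rw [Real.exp_le_exp]
    refine le_trans ?_ hdrift
    gcongr
    have h3 := mul_le_mul_of_nonneg_right (mul_le_mul_of_nonneg_left hu (hα (n + 1))) (sq_nonneg B)
    linarith
  -- The value of `avgWeight` is chosen so that `(1 - λ) e = 1/2`.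
  have h4 : (1 - avgWeight) * (u * Real.exp (t * (R - R'))) ≤ 1 / 2 * u := by
    have h5 : (1 - avgWeight) * (u * Real.exp (t * (R - R'))) ≤
        (1 - avgWeight) * (u * Real.exp 1) :=
      mul_le_mul_of_nonneg_left (mul_le_mul_of_nonneg_left hexp hu0.le) one_sub_avgWeight_pos.le
    refine h5.trans (le_of_eq ?_)
    rw [one_sub_avgWeight]
    field_simp
  have h6 := mul_le_mul_of_nonneg_right h4 hδ'
  -- The step length is proportional to `u⁻¹`, which cancels the weight `u`; no factor `q` appears.
  have h7 : u * (R' - R) ≤ α (n + 1) * B ^ 2 := by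
    refine (mul_le_mul_of_nonneg_left habs.2 hu0.le).trans (le_of_eq ?_)
    field_simp
  linarith

/-- The expected descent of one pass. -/
theorem gap_succ_le (hN : 0 < N) (ht : 0 < t) (hμ : 0 < μ) (hΘ : IsOpen Θ)
    (hf_diff : ∀ i, DifferentiableOn ℝ (f i) Θ)
    (hf : ∀ i, ∀ θ ∈ Θ, Fmin ≤ f i θ ∧ f i θ ≤ Fmax)
    (hR : IsSmoothOn β (tiltedRisk f t) Θ)
    (hgrad : ∀ i, ∀ θ ∈ Θ, ‖tiltedStochGrad f t i θ‖ ≤ B) (hα : ∀ n, 0 ≤ α n)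
    (hPL : ∀ p ∈ stdSimplex ℝ (Fin N), IsPLOn (μ / 2) (fun θ => ∑ i, p i * f i θ) Θ)
    (hζ : ∀ k, Measurable (ζ k)) (hξ : ∀ k, Measurable (ξ k))
    (hindep : iIndepFun (Sum.elim ζ ξ) P)
    (hζ_unif : ∀ k i, P.real (ζ k ⁻¹' {i}) = 1 / (N : ℝ))
    (hξ_unif : ∀ k i, P.real (ξ k ⁻¹' {i}) = 1 / (N : ℝ))
    (hadm : ∀ᵐ ω ∂P, Admissible f Θ t Fmin Fmax α θ₁ ζ ξ ω) (hopt_mem : θopt ∈ Θ) (n : ℕ) :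
    gap P f t α θ₁ θopt ζ ξ (n + 1) ≤ gap P f t α θ₁ θopt ζ ξ n -
      α (n + 1) * (μ * weightedGap P f t α θ₁ θopt ζ ξ (fun u => u⁻¹) n) +
      β / 2 * α (n + 1) ^ 2 * (Real.exp (t * (Fmax - Fmin)) ^ 2 * B ^ 2) := by
  have hN' : (0 : ℝ) < N := by exact_mod_cast hN
  have hi := integrable_state (P := P) (f := f) (t := t) (α := α) (θ₁ := θ₁) hN hζ hξ
    (fun s => tiltedRisk f t s.1 - tiltedRisk f t θopt)
  set q := Real.exp (t * (Fmax - Fmin)) with hq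
  obtain ⟨hHi, hH⟩ := integral_next (f := f) (t := t) (lam := avgWeight) (α := α) (θ₁ := θ₁)
    hN hζ hξ hindep hζ_unif hξ_unif
    (fun s i j => (estRatio f t s j)⁻¹ *
      inner ℝ (gradient (tiltedRisk f t) s.1) (tiltedStochGrad f t i s.1)) n
  -- the expected inner product controls the weighted gap
  have hPLint : μ * weightedGap P f t α θ₁ θopt ζ ξ (fun u => u⁻¹) n ≤
      ∫ ω, (estRatio f t (state f t α θ₁ ζ ξ n ω) (ξ (n + 1) ω))⁻¹ *
        inner ℝ (gradient (tiltedRisk f t) (state f t α θ₁ ζ ξ n ω).1)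
          (tiltedStochGrad f t (ζ (n + 1) ω) (state f t α θ₁ ζ ξ n ω).1) ∂P := by
    refine le_trans ?_ hH.ge
    rw [weightedGap_eq hN hζ hξ hindep hζ_unif hξ_unif, ← integral_const_mul]
    refine integral_mono_ae ((integrable_state hN hζ hξ
      (fun s => ((1 / (N : ℝ)) * ∑ j, (estRatio f t s j)⁻¹) *
        (tiltedRisk f t s.1 - tiltedRisk f t θopt)) n).const_mul μ)
      (integrable_state hN hζ hξ (fun s => (1 / (N : ℝ)) * ∑ i, (1 / (N : ℝ)) * ∑ j,
        (estRatio f t s j)⁻¹ *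
          inner ℝ (gradient (tiltedRisk f t) s.1) (tiltedStochGrad f t i s.1)) n) ?_
    filter_upwards [hadm] with ω hω
    change _ ≤ (1 / (N : ℝ)) * ∑ i, (1 / (N : ℝ)) * ∑ j,
      (estRatio f t (state f t α θ₁ ζ ξ n ω) j)⁻¹ *
        inner ℝ (gradient (tiltedRisk f t) (state f t α θ₁ ζ ξ n ω).1)
          (tiltedStochGrad f t i (state f t α θ₁ ζ ξ n ω).1)
    set s := state f t α θ₁ ζ ξ n ω
    have hs : s.1 ∈ Θ := hω.mem n
    have hdiff : ∀ i, DifferentiableAt ℝ (f i) s.1 := fun i =>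
      (hf_diff i).differentiableAt (hΘ.mem_nhds hs)
    have h1 := tiltedRisk_PL hN ht hs hopt_mem hμ hdiff hPL
    -- Two separate mini-batches make the double average factor into the mean of `u⁻¹` and `⟪∇R,
    -- mean gradient⟫ = ‖∇R‖²`.
    have h2 : (1 / (N : ℝ)) * ∑ i, (1 / (N : ℝ)) * ∑ j, (estRatio f t s j)⁻¹ *
        inner ℝ (gradient (tiltedRisk f t) s.1) (tiltedStochGrad f t i s.1) =
        ((1 / (N : ℝ)) * ∑ j, (estRatio f t s j)⁻¹) * ‖gradient (tiltedRisk f t) s.1‖ ^ 2 := by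
      have h3 : ‖gradient (tiltedRisk f t) s.1‖ ^ 2 = (1 / (N : ℝ)) *
          ∑ i, inner ℝ (gradient (tiltedRisk f t) s.1) (tiltedStochGrad f t i s.1) := by
        rw [← inner_sum, ← inner_smul_right, ← (hasGradientAt_tiltedRisk hN ht hdiff).gradient,
          real_inner_self_eq_norm_sq]
      rw [h3]
      simp only [← Finset.sum_mul, ← Finset.mul_sum]
      ring
    rw [h2]
    have h4 : 0 ≤ (1 / (N : ℝ)) * ∑ j, (estRatio f t s j)⁻¹ :=
      mul_nonneg (by positivity)
        (Finset.sum_nonneg fun j _ => (inv_pos.2 (estRatio_pos s j)).le)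
    linarith [mul_le_mul_of_nonneg_left h1 h4]
  have hHi' : Integrable (fun ω => (estRatio f t (state f t α θ₁ ζ ξ n ω) (ξ (n + 1) ω))⁻¹ *
        inner ℝ (gradient (tiltedRisk f t) (state f t α θ₁ ζ ξ n ω).1)
          (tiltedStochGrad f t (ζ (n + 1) ω) (state f t α θ₁ ζ ξ n ω).1)) P := hHi
  have hdescent : gap P f t α θ₁ θopt ζ ξ (n + 1) ≤
      ∫ ω, ((tiltedRisk f t (state f t α θ₁ ζ ξ n ω).1 - tiltedRisk f t θopt) -
        α (n + 1) * ((estRatio f t (state f t α θ₁ ζ ξ n ω) (ξ (n + 1) ω))⁻¹ *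
          inner ℝ (gradient (tiltedRisk f t) (state f t α θ₁ ζ ξ n ω).1)
            (tiltedStochGrad f t (ζ (n + 1) ω) (state f t α θ₁ ζ ξ n ω).1)) +
        β / 2 * α (n + 1) ^ 2 * (q ^ 2 * B ^ 2)) ∂P := by
    refine integral_mono_ae (hi (n + 1))
      (((hi n).sub (hHi'.const_mul _)).add (integrable_const _)) ?_
    filter_upwards [hadm] with ω hω
    have hsub : (state f t α θ₁ ζ ξ (n + 1) ω).1 - (state f t α θ₁ ζ ξ n ω).1 = _ :=
      step_fst_sub ht (α (n + 1)) (ζ (n + 1) ω) (ξ (n + 1) ω) (state f t α θ₁ ζ ξ n ω)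
    have h1 := hR.le_quadratic hΘ (hω n).1
    have hu := (estRatio_mem hN ht (hω n).2 (fun i => hf i _ (hω.mem n)) (ξ (n + 1) ω)).1
    have hu0 := inv_pos.2
      (estRatio_pos (f := f) (t := t) (state f t α θ₁ ζ ξ n ω) (ξ (n + 1) ω))
    have hg := hgrad (ζ (n + 1) ω) _ (hω.mem n)
    have hα' := hα (n + 1)
    rw [hsub, norm_neg, norm_smul, Real.norm_of_nonneg (by positivity), inner_neg_right,
      inner_smul_right] at h1
    have h2 : β / 2 * (α (n + 1) * (estRatio f t (state f t α θ₁ ζ ξ n ω) (ξ (n + 1) ω))⁻¹ *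
        ‖tiltedStochGrad f t (ζ (n + 1) ω) (state f t α θ₁ ζ ξ n ω).1‖) ^ 2 ≤
        β / 2 * α (n + 1) ^ 2 * (q ^ 2 * B ^ 2) := by
      calc _ ≤ (β : ℝ) / 2 * (α (n + 1) * q * B) ^ 2 := by gcongr
        _ = _ := by ring
    linarith
  have hsplit : ∫ ω, ((tiltedRisk f t (state f t α θ₁ ζ ξ n ω).1 - tiltedRisk f t θopt) -
        α (n + 1) * ((estRatio f t (state f t α θ₁ ζ ξ n ω) (ξ (n + 1) ω))⁻¹ *
          inner ℝ (gradient (tiltedRisk f t) (state f t α θ₁ ζ ξ n ω).1)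
            (tiltedStochGrad f t (ζ (n + 1) ω) (state f t α θ₁ ζ ξ n ω).1)) +
        β / 2 * α (n + 1) ^ 2 * (q ^ 2 * B ^ 2)) ∂P =
      gap P f t α θ₁ θopt ζ ξ n - α (n + 1) *
        (∫ ω, (estRatio f t (state f t α θ₁ ζ ξ n ω) (ξ (n + 1) ω))⁻¹ *
          inner ℝ (gradient (tiltedRisk f t) (state f t α θ₁ ζ ξ n ω).1)
            (tiltedStochGrad f t (ζ (n + 1) ω) (state f t α θ₁ ζ ξ n ω).1) ∂P) +
        β / 2 * α (n + 1) ^ 2 * (q ^ 2 * B ^ 2) := by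
    rw [integral_add ((hi n).sub' (hHi'.const_mul _)) (integrable_const _),
      integral_sub (hi n) (hHi'.const_mul _), integral_const_mul]
    simp [gap]
  rw [hsplit] at hdescent
  linarith [mul_le_mul_of_nonneg_left hPLint (hα (n + 1))]

end Estimates

end TERM

/-! ### Assembly. -/

theorem mainTheorem11 {Ω : Type*} [MeasurableSpace Ω] (P : Measure Ω) [IsProbabilityMeasure P]
    {d N : ℕ} (hN : 0 < N)
    (f : Fin N → EuclideanSpace ℝ (Fin d) → ℝ) (Θ : Set (EuclideanSpace ℝ (Fin d)))
    (t μ B Fmin Fmax : ℝ) (L β : ℝ≥0) (θ₁ θopt : EuclideanSpace ℝ (Fin d))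
    (ζ ξ : ℕ → Ω → Fin N)
    (ht : 0 < t) (hμ : 0 < μ)
    -- the parameter domain
    (hΘ_open : IsOpen Θ) (hΘ_conn : IsConnected Θ)
    -- the losses: differentiable, bounded and `L`-Lipschitz on `Θ`
    (hf_diff : ∀ i, DifferentiableOn ℝ (f i) Θ)
    (hf_bdd : ∀ i, ∀ θ ∈ Θ, Fmin ≤ f i θ ∧ f i θ ≤ Fmax)
    (hf_lip : ∀ i, LipschitzOnWith L (f i) Θ)
    -- the tilted risk: `β`-smooth, with bounded stochastic gradients
    (hR_smooth : TERM.IsSmoothOn β (TERM.tiltedRisk f t) Θ)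
    (hR_grad : ∀ i, ∀ θ ∈ Θ, ‖TERM.tiltedStochGrad f t i θ‖ ≤ B)
    -- every convex combination of the losses is `μ/2`-PL
    (hPL : ∀ p ∈ stdSimplex ℝ (Fin N), TERM.IsPLOn (μ / 2) (fun θ => ∑ i, p i * f i θ) Θ)
    -- a `t`-tilted solution
    (hopt_mem : θopt ∈ Θ) (hopt : IsMinOn (TERM.tiltedRisk f t) Θ θopt)
    -- the samples: independent and uniform on `{0, …, N-1}`
    (hζ_meas : ∀ k, Measurable (ζ k)) (hξ_meas : ∀ k, Measurable (ξ k))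
    (hindep : iIndepFun (Sum.elim ζ ξ) P)
    (hζ_unif : ∀ k i, P.real (ζ k ⁻¹' {i}) = 1 / (N : ℝ))
    (hξ_unif : ∀ k i, P.real (ξ k ⁻¹' {i}) = 1 / (N : ℝ))
    -- the run starts in `Θ` and stays there
    (hθ₁ : θ₁ ∈ Θ)
    (hstay : ∀ k, ∀ᵐ ω ∂P, segment ℝ (TERM.solver f t μ L B Fmin Fmax θ₁ ζ ξ k ω)
      (TERM.solver f t μ L B Fmin Fmax θ₁ ζ ξ (k + 1) ω) ⊆ Θ) :
    (∀ k, Integrable (fun ω => TERM.tiltedRisk f t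
        (TERM.solver f t μ L B Fmin Fmax θ₁ ζ ξ k ω) - TERM.tiltedRisk f t θopt) P) ∧
    ∀ k, TERM.burnIn t μ L B Fmin Fmax ≤ k →
      ∫ ω, (TERM.tiltedRisk f t (TERM.solver f t μ L B Fmin Fmax θ₁ ζ ξ (k + 1) ω)
          - TERM.tiltedRisk f t θopt) ∂P
        ≤ max ((TERM.burnIn t μ L B Fmin Fmax : ℝ) *
              ∫ ω, (TERM.tiltedRisk f t (TERM.solver f t μ L B Fmin Fmax θ₁ ζ ξ
                (TERM.burnIn t μ L B Fmin Fmax) ω) - TERM.tiltedRisk f t θopt) ∂P)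
            (8 * β * B ^ 2 * Real.exp (2 * t * (Fmax - Fmin) + 2) / μ ^ 2)
          / ((k : ℝ) + 1) := by
  have hi0 : Fin N := ⟨0, hN⟩
  have hB : 0 ≤ B := (norm_nonneg _).trans (hR_grad hi0 θ₁ hθ₁)
  have hL : (0 : ℝ) ≤ L := L.coe_nonneg
  set α := TERM.stepSize t μ L B Fmin Fmax with hαdef
  have hα0 : ∀ n, 0 ≤ α n := TERM.stepSize_nonneg ht hμ hL hB
  have hadm : ∀ᵐ ω ∂P, TERM.Admissible f Θ t Fmin Fmax α θ₁ ζ ξ ω := by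
    filter_upwards [ae_all_iff.2 hstay] with ω hω
    exact TERM.admissible_of_segment hN ht hf_bdd fun n => hω (n + 1)
  refine ⟨fun k => TERM.integrable_state hN hζ_meas hξ_meas
    (fun s => TERM.tiltedRisk f t s.1 - TERM.tiltedRisk f t θopt) (k - 1), fun k hk => ?_⟩
  set K := TERM.burnIn t μ L B Fmin Fmax with hK
  -- `gap` counts passes, so iterate `k + 1` is `gap k`. For `K = 0` the truncated `K - 1` is
  -- harmless, being multiplied by 0.
  change TERM.gap P f t α θ₁ θopt ζ ξ k ≤
    max (K * TERM.gap P f t α θ₁ θopt ζ ξ (K - 1)) _ / _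
  have hdiff : ∀ θ ∈ Θ, ∀ i, DifferentiableAt ℝ (f i) θ := fun θ hθ i =>
    (hf_diff i).differentiableAt (hΘ_open.mem_nhds hθ)
  have hPLR : ∀ θ ∈ Θ, μ * (TERM.tiltedRisk f t θ - TERM.tiltedRisk f t θopt) ≤
      ‖gradient (TERM.tiltedRisk f t) θ‖ ^ 2 := fun θ hθ =>
    TERM.tiltedRisk_PL hN ht hθ hopt_mem hμ (hdiff θ hθ) hPL
  rcases lt_or_ge (β : ℝ) (μ / 2) with hβ | hβ
  · have hconst := hR_smooth.eq_of_lt hΘ_open hΘ_conn.isPreconnected hopt_mem hopt hμ hPLR hβ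
    refine (TERM.gap_le_of_forall hN hζ_meas hξ_meas hadm
      (fun θ hθ => (sub_eq_zero.2 (hconst θ hθ)).le) k).trans ?_
    exact div_nonneg (le_max_of_le_right (by positivity)) (by positivity)
  have hrange := fun θ hθ => TERM.tiltedRisk_mem (a := Fmin) (b := Fmax) hN ht
    fun i => hf_bdd i θ hθ
  have hweight := fun {φ : ℝ → ℝ} {c e : ℝ} => TERM.gap_mul_le_weightedGap (φ := φ) (c := c)
    (e := e) hN ht hζ_meas hξ_meas hindep hζ_unif hξ_unif hf_bdd hadm hopt
  refine TERM.rate (Δ := Fmax - Fmin) (lam := TERM.avgWeight) (α := α) (K := K) (B := B)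
    (D := TERM.gap P f t α θ₁ θopt ζ ξ)
    (A := TERM.weightedGap P f t α θ₁ θopt ζ ξ id)
    (W := TERM.weightedGap P f t α θ₁ θopt ζ ξ fun u => u⁻¹)
    hμ ht rfl ?_ TERM.avgWeight_le_one hβ (TERM.stepSize_le ht hμ hL hB)
    (fun j hj => TERM.stepSize_of_le hj) (TERM.gap_nonneg hadm hopt) ?_ ?_
    (TERM.gap_succ_le hN ht hμ hΘ_open hf_diff hf_bdd hR_smooth hR_grad hα0 hPL hζ_meas hξ_meas
      hindep hζ_unif hξ_unif hadm hopt_mem)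
    ?_ ?_ ?_
    (TERM.weightedGap_succ_le hN ht hΘ_open hf_diff hf_bdd hR_smooth.1 hR_grad hB hα0 hζ_meas
      hξ_meas hindep hζ_unif hξ_unif hadm hopt)
    (TERM.gap_le_succ hN ht hΘ_open hf_diff hf_bdd hR_smooth.1 hR_grad hB hα0 hζ_meas hξ_meas hadm)
    ?_ (le_max_left _ _) k hk
  · exact sub_nonneg.2 ((hf_bdd hi0 θ₁ hθ₁).1.trans (hf_bdd hi0 θ₁ hθ₁).2)
  · refine TERM.gap_le_of_forall hN hζ_meas hξ_meas hadm fun θ hθ => ?_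
    rw [le_div_iff₀ hμ, mul_comm]
    refine (hPLR θ hθ).trans (pow_le_pow_left₀ (norm_nonneg _) ?_ 2)
    exact TERM.norm_gradient_tiltedRisk_le hN ht (hdiff θ hθ) fun i => hR_grad i θ hθ
  · refine TERM.gap_le_of_forall hN hζ_meas hξ_meas hadm fun θ hθ => ?_
    linarith [(hrange θ hθ).2, (hrange θopt hopt_mem).1]
  · intro n
    have h := hweight (φ := fun u => u⁻¹) (c := (Real.exp (t * (Fmax - Fmin)))⁻¹) (e := 0)
      (fun u hu _ h2 => by
        rw [zero_mul, add_zero]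
        exact inv_anti₀ hu h2) n
    rw [div_eq_inv_mul]
    linarith
  · intro n
    -- `u⁻¹ ≥ 1 - u/4` is the tangent at `u = 2`, the asymptotic bound on the ratio `A/D`.
    have h := hweight (φ := fun u => u⁻¹) (c := 1) (e := 1 / 4)
      (fun u hu _ _ => by
        have : u⁻¹ + 1 / 4 * u - 1 = (u / 2 - 1) ^ 2 / u := by field_simp; ring
        have h' : 0 ≤ (u / 2 - 1) ^ 2 / u := by positivity
        linarith) n
    linarith
  · intro n
    -- With `φ = 0` and negative constants, the comparison of weights becomes the upper bound `u ≤
    -- q`.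
    have h := hweight (φ := fun _ => 0) (c := -Real.exp (t * (Fmax - Fmin))) (e := -1)
      (fun u _ _ h2 => by linarith) n
    have h0 : TERM.weightedGap P f t α θ₁ θopt ζ ξ (fun _ => 0) n = 0 := by
      simp [TERM.weightedGap]
    linarith
  · refine le_trans (le_of_eq ?_) (le_max_right _ _)
    rw [Real.exp_add, show 2 * t * (Fmax - Fmin) = t * (Fmax - Fmin) + t * (Fmax - Fmin) by ring,
      Real.exp_add, show (2 : ℝ) = 1 + 1 by norm_num, Real.exp_add]
    ring
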